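/- **Theorem 1.1.** Let $n\ge 1$ be an integer, $m>0$, $R\in\mathbb R$, and set $\phi(t)=\frac{2}{m+2}t^{\frac{m+2}{2}}$ and $$\gamma(m,n,p)=-\Big((m+2)\tfrac n2-1\Big)p^2-\Big((m+2)\big(1-\tfrac n2\big)-3\Big)p+(m+2).$$ Let $p_{crit}(m,n)$ be the positive root $p$ of $\gamma(m,n,p)=0$ and let $1<p<p_{crit}(m,n)$. Let $u_0,u_1\in C_0^\infty(\mathbb R^n)$ be nonnegative, not both identically zero, and supported in $\{|x|\le R\}$. For $\varepsilon>0$ consider the Cauchy problem $$u_{tt}-t^m\Delta u=|u|^p,\qquad u(x,0)=\varepsilon u_0(x),\quad u_t(x,0)=\varepsilon u_1(x),\qquad x\in\mathbb R^n,\ t\ge 0.$$ For $0<T\le\infty$, an energy solution on $[0,T)$ is a function $u$ with $(u,u_t)\in C([0,T),H^1(\mathbb R^n)\times L^2(\mathbb R^n))$ which has these initial values, for which $|u|^p$ is locally integrable (for each $K\subset\mathbb R^n$ compact, $\int_K|u(x,s)|^p\,dx$ is finite for every $s\in[0,T)$ and is integrable in $s$ over $[0,t]$ for every $t<T$), and which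 satisfies, for all $\zeta\in C_0^\infty(\mathbb R^n\times[0,T))$ and all $t\in[0,T)$, $$\int u_t(x,t)\zeta(x,t)\,dx-\int u_t(x,0)\zeta(x,0)\,dx-\int_0^t\!\!\int\big(u_s\zeta_s-s^m\nabla u\cdot\nabla\zeta\big)(x,s)\,dx\,ds=\int_0^t\!\!\int|u(x,s)|^p\zeta(x,s)\,dx\,ds .$$ Let the lifespan $T(\varepsilon)$ be the supremum of all $T\in(0,\infty]$ for which there is an energy solution $u$ on $[0,T)$ with $$\operatorname{supp}u\subset\{(x,t)\in\mathbb R^n\times[0,T):|x|\le R+\phi(t)\}$$ (with supremum $0$ if there is none). Then for every $\varepsilon_0>0$ there is a constant $C>0$, independent of $\varepsilon$, such that for all $\varepsilon\in(0,\varepsilon_0]$ $$T(\varepsilon)<\infty\qquad\text{and}\qquad T(\varepsilon)\le C\,\varepsilon^{-\frac{2p(p-1)}{\gamma(m,n,p)}} .$$ -/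

import Mathlib

open MeasureTheory Set
open scoped ENNReal ContDiff Gradient

noncomputable section

/-- The quadratic polynomial `γ(m, n, p)` whose positive root in `p` is the critical exponent. -/
def tricomiGamma (m : ℝ) (n : ℕ) (p : ℝ) : ℝ :=
  -((m + 2) * (n / 2) - 1) * p ^ 2 - ((m + 2) * (1 - n / 2) - 3) * p + (m + 2)

/-- `φ(t) = 2 / (m + 2) * t ^ ((m + 2) / 2)`, used for `t ≥ 0`. -/
def tricomiPhi (m t : ℝ) : ℝ := 2 / (m + 2) * t ^ ((m + 2) / 2)

/-- The time interval `[0, T)`, where `T = ∞` is allowed. -/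
def timeInterval (T : ℝ≥0∞) : Set ℝ := {t | 0 ≤ t ∧ ENNReal.ofReal t < T}

/-- `g` is the weak (distributional) gradient of `f` on `ℝⁿ`, both being square integrable.
Together with `f ∈ L²` this says `f ∈ H¹(ℝⁿ)` and `∇f = g`. -/
def HasWeakGradient {n : ℕ} (f : Lp ℝ 2 (volume : Measure (EuclideanSpace ℝ (Fin n))))
    (g : Lp (EuclideanSpace ℝ (Fin n)) 2 (volume : Measure (EuclideanSpace ℝ (Fin n)))) : Prop :=
  ∀ χ : EuclideanSpace ℝ (Fin n) → ℝ, ContDiff ℝ ∞ χ → HasCompactSupport χ →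
    ∀ v : EuclideanSpace ℝ (Fin n),
      ∫ x, f x * fderiv ℝ χ x v = -∫ x, inner ℝ (g x) v * χ x

/-- Test functions on `ℝⁿ × [0, T)` (time is the first argument): restrictions to nonnegative
times of smooth compactly supported functions whose support lies in the times `< T`.
They need not vanish at time `0`. -/
structure IsTestFunction {n : ℕ} (T : ℝ≥0∞) (ζ : ℝ → EuclideanSpace ℝ (Fin n) → ℝ) : Prop where
  smooth : ContDiff ℝ ∞ (fun z : ℝ × EuclideanSpace ℝ (Fin n) => ζ z.1 z.2)
  compact : HasCompactSupport (fun z : ℝ × EuclideanSpace ℝ (Fin n) => ζ z.1 z.2)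
  before : ∀ z ∈ tsupport (fun z : ℝ × EuclideanSpace ℝ (Fin n) => ζ z.1 z.2),
    ENNReal.ofReal z.1 < T

/-- `u` is an energy solution on `[0, T)` of
`u_tt - t ^ m Δu = |u| ^ p`, `u(0) = ε u₀`, `u_t(0) = ε u₁`.
The witnesses `w` and `g` are `u_t` and `∇u`. The conditions `deriv` and `cont_deriv` say
`u ∈ C¹([0, T); L²)`, and `weak_grad` and `cont_grad` add `u ∈ C([0, T); H¹)`. The conditions
`loc` and `loc_time` say that `|u| ^ p` is locally integrable, so that the right-hand side of the
weak equation is meaningful. -/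
structure IsEnergySolutionWith {n : ℕ} (m p ε : ℝ) (u₀ u₁ : EuclideanSpace ℝ (Fin n) → ℝ)
    (T : ℝ≥0∞) (u w : ℝ → Lp ℝ 2 (volume : Measure (EuclideanSpace ℝ (Fin n))))
    (g : ℝ → Lp (EuclideanSpace ℝ (Fin n)) 2 (volume : Measure (EuclideanSpace ℝ (Fin n)))) :
    Prop where
  time_pos : 0 < T
  deriv : ∀ t ∈ timeInterval T, HasDerivWithinAt u (w t) (timeInterval T) t
  cont_deriv : ContinuousOn w (timeInterval T)
  weak_grad : ∀ t ∈ timeInterval T, HasWeakGradient (u t) (g t)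
  cont_grad : ContinuousOn g (timeInterval T)
  init : u 0 =ᵐ[volume] fun x => ε * u₀ x
  init_deriv : w 0 =ᵐ[volume] fun x => ε * u₁ x
  loc : ∀ K : Set (EuclideanSpace ℝ (Fin n)), IsCompact K → ∀ t ∈ timeInterval T,
    IntegrableOn (fun x => |u t x| ^ p) K
  loc_time : ∀ K : Set (EuclideanSpace ℝ (Fin n)), IsCompact K → ∀ t ∈ timeInterval T,
    IntervalIntegrable (fun s => ∫ x in K, |u s x| ^ p) volume 0 t
  weak_eq : ∀ ζ : ℝ → EuclideanSpace ℝ (Fin n) → ℝ, IsTestFunction T ζ →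
    ∀ t ∈ timeInterval T,
      (∫ x, w t x * ζ t x) - (∫ x, w 0 x * ζ 0 x)
        - (∫ s in (0 : ℝ)..t, ∫ x,
            (w s x * _root_.deriv (fun r => ζ r x) s - s ^ m * inner ℝ (g s x) (∇ (ζ s) x)))
      = ∫ s in (0 : ℝ)..t, ∫ x, |u s x| ^ p * ζ s x

/-- Energy solutions, with `u_t` and `∇u` (which are determined by `u`) left implicit. -/
def IsEnergySolution {n : ℕ} (m p ε : ℝ) (u₀ u₁ : EuclideanSpace ℝ (Fin n) → ℝ)
    (T : ℝ≥0∞) (u : ℝ → Lp ℝ 2 (volume : Measure (EuclideanSpace ℝ (Fin n)))) : Prop :=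
  ∃ w g, IsEnergySolutionWith m p ε u₀ u₁ T u w g

/-- On `[0, T)` the function `u` is supported in the cone `|x| ≤ R + φ(t)`. -/
def SupportedInCone {n : ℕ} (m R : ℝ) (T : ℝ≥0∞)
    (u : ℝ → Lp ℝ 2 (volume : Measure (EuclideanSpace ℝ (Fin n)))) : Prop :=
  ∀ t ∈ timeInterval T, ∀ᵐ x, R + tricomiPhi m t < ‖x‖ → u t x = 0

/-- The lifespan `T(ε)`: the supremum of all `T ∈ (0, ∞]` such that there is an energy solution
on `[0, T)` supported in the cone `|x| ≤ R + φ(t)`. -/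
def lifespan {n : ℕ} (m p R : ℝ) (u₀ u₁ : EuclideanSpace ℝ (Fin n) → ℝ) (ε : ℝ) : ℝ≥0∞ :=
  sSup {T | ∃ u, IsEnergySolution m p ε u₀ u₁ T u ∧ SupportedInCone m R T u}

end

/-!
The proof tests the equation with functions of the space variable only. Since `u` is supported in
the cone, `η` may be any smooth function, cut off outside the cone, and if `Δη = c η` then
`y(t) = ∫ u(t) η` solves `y'' = c t ^ m y + ∫ |u| ^ p η` in integrated form
(`IsEnergySolutionWith.integral_eq_of_eigenfunction`).

With `η(x) = exp ⟪x, ξ⟫` for a unit vector `ξ`, the source is nonnegative and `y'' ≥ t ^ m y`.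
Comparison with an explicit subsolution gives `y(t) ≥ c ε t ^ (-m / 4) exp (φ(t))`, uniformly in `ξ`
(`exists_lower_bound_of_deriv_ge`, `exists_lintegral_exp_lower`). This replaces the Bessel-function
multiplier in time and the spherical eigenfunction of the Laplacian: the average over `ξ` is taken
only after the estimate, so that nothing but the upper bound
`∫ exp ⟪x, ξ⟫ dξ ≤ C exp ‖x‖ (1 + ‖x‖) ^ (-(n - 1) / 2)` is needed
(`exists_lintegral_exp_inner_le`). Hölder's inequality on the cone then yields
`∫ |u(t)| ^ p ≥ c ε ^ p t ^ (-α)` with `α = m p / 4 + (m + 2) (n - 1) (p - 2) / 4`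
(`exists_integral_rpow_lower`).

With `η = 1`, the function `y = ∫ u` satisfies `y'' = ∫ |u| ^ p`, and Hölder's inequality gives
`y'' ≥ c t ^ (-(m + 2) n (p - 1) / 2) |y| ^ p` (`exists_spatial_integral`). If the solution exists on
`[0, 3 τ]`, the bound above makes `y(2 τ) ≥ c ε ^ p τ ^ (2 - α)`, and on `[2 τ, 3 τ]` the
superlinear inequality makes `y` double in geometrically shrinking time steps
(`length_lt_of_superlinear`). This is impossible once `ε ^ (p (p - 1)) τ ^ (γ / 2)` is large
(`exists_rpow_mul_rpow_lt`), where the exponent arises from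
`2 + (2 - α) (p - 1) - (m + 2) n (p - 1) / 2 = γ(m, n, p) / 2`.
-/

/-! ### Second-order differential inequalities -/

/-- The strict form of `nonneg_of_deriv_ge_integral`: up to the first zero of `D` the derivative `E`
stays nonnegative, so `D` cannot have dropped from `D a > 0`. -/
theorem pos_of_deriv_ge_integral {a b : ℝ} {D E q : ℝ → ℝ}
    (hD : ∀ t ∈ Icc a b, HasDerivWithinAt D (E t) (Icc a b) t)
    (hq0 : ∀ t ∈ Icc a b, 0 ≤ q t)
    (hE : ∀ t ∈ Icc a b, E a + ∫ s in a..t, q s * D s ≤ E t)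
    (hDa : 0 < D a) (hEa : 0 ≤ E a) : ∀ t ∈ Icc a b, 0 < D t := by
  by_contra! hneg
  have hcont : ContinuousOn D (Icc a b) := fun t ht => (hD t ht).continuousWithinAt
  have hcl : IsClosed (Icc a b ∩ D ⁻¹' Iic 0) :=
    hcont.preimage_isClosed_of_isClosed isClosed_Icc isClosed_Iic
  have hcpt : IsCompact (Icc a b ∩ D ⁻¹' Iic 0) := isCompact_Icc.of_isClosed_subset hcl
    inter_subset_left
  obtain ⟨t, ht, htD⟩ := hneg
  obtain ⟨τ, ⟨hτ, hτD⟩, hleast⟩ := hcpt.exists_isLeast ⟨t, ht, htD⟩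
  have hpos : ∀ s ∈ Ico a τ, 0 < D s := by
    intro s hs
    by_contra! h
    exact absurd (hleast ⟨⟨hs.1, hs.2.le.trans hτ.2⟩, h⟩) (not_le.2 hs.2)
  have hsub : Icc a τ ⊆ Icc a b := Icc_subset_Icc_right hτ.2
  have hmono : MonotoneOn D (Icc a τ) := by
    refine monotoneOn_of_hasDerivWithinAt_nonneg (f' := E) (convex_Icc a τ) (hcont.mono hsub)
      (fun x hx => (hD x (hsub (interior_subset hx))).mono (interior_subset.trans hsub)) ?_
    intro x hx
    rw [interior_Icc] at hx
    have := hE x (hsub ⟨hx.1.le, hx.2.le⟩)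
    have h2 : 0 ≤ ∫ s in a..x, q s * D s :=
      intervalIntegral.integral_nonneg hx.1.le fun s hs =>
        mul_nonneg (hq0 s (hsub ⟨hs.1, hs.2.trans hx.2.le⟩))
          (hpos s ⟨hs.1, hs.2.trans_lt hx.2⟩).le
    linarith
  have := hmono ⟨le_rfl, hτ.1⟩ ⟨hτ.1, le_rfl⟩ hτ.1
  have h3 : D τ ≤ 0 := hτD
  linarith

/-- Comparison principle for `D'' ≥ q D` with `q ≥ 0` and nonnegative data at `a`, where `E = D'` and
the inequality is integrated once from `a`. -/
theorem nonneg_of_deriv_ge_integral {a b : ℝ} {D E q : ℝ → ℝ}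
    (hD : ∀ t ∈ Icc a b, HasDerivWithinAt D (E t) (Icc a b) t)
    (hq : ContinuousOn q (Icc a b)) (hq0 : ∀ t ∈ Icc a b, 0 ≤ q t)
    (hE : ∀ t ∈ Icc a b, E a + ∫ s in a..t, q s * D s ≤ E t)
    (hDa : 0 ≤ D a) (hEa : 0 ≤ E a) : ∀ t ∈ Icc a b, 0 ≤ D t := by
  obtain ⟨M, hM⟩ := isCompact_Icc.exists_bound_of_continuousOn hq
  set Q : ℝ := 1 + |M| with hQ
  have hQ1 : 1 ≤ Q := by have := abs_nonneg M; linarith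
  have hqQ : ∀ s ∈ Icc a b, q s ≤ Q ^ 2 := by
    intro s hs
    have h1 := hM s hs
    rw [Real.norm_eq_abs] at h1
    have h2 := le_abs_self (q s)
    have h3 := le_abs_self M
    nlinarith
  have hcont : ContinuousOn D (Icc a b) := fun t ht => (hD t ht).continuousWithinAt
  -- `exp (Q (t - a))` is a strict supersolution, so adding a multiple of it makes `D` positive.
  have key : ∀ μ : ℝ, 0 < μ → ∀ t ∈ Icc a b, 0 < D t + μ * Real.exp (Q * (t - a)) := by
    intro μ hμ
    have hz : ∀ t, HasDerivAt (fun t => μ * Real.exp (Q * (t - a)))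
        (μ * (Real.exp (Q * (t - a)) * Q)) t := by
      intro t
      have h1 : HasDerivAt (fun t => Q * (t - a)) Q t := by
        simpa using ((hasDerivAt_id t).sub_const a).const_mul Q
      exact (h1.exp).const_mul μ
    refine pos_of_deriv_ge_integral (E := fun t => E t + μ * (Real.exp (Q * (t - a)) * Q)) (q := q)
      (fun t ht => (hD t ht).add (hz t).hasDerivWithinAt) hq0 ?_ ?_ ?_
    · intro t ht
      have hsub : uIcc a t ⊆ Icc a b := by
        rw [uIcc_of_le ht.1]; exact Icc_subset_Icc_right ht.2
      have hi1 : IntervalIntegrable (fun s => q s * D s) volume a t :=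
        ((hq.mul hcont).mono hsub).intervalIntegrable
      have hc2 : ContinuousOn (fun s => q s * (μ * Real.exp (Q * (s - a)))) (uIcc a t) :=
        (hq.mono hsub).mul (by fun_prop)
      have hi2 := hc2.intervalIntegrable (μ := volume)
      have hi3 : IntervalIntegrable (fun s => μ * (Real.exp (Q * (s - a)) * Q) * Q) volume a t :=
        Continuous.intervalIntegrable (by fun_prop) _ _
      have h1 : ∫ s in a..t, q s * (D s + μ * Real.exp (Q * (s - a)))
          = (∫ s in a..t, q s * D s) + ∫ s in a..t, q s * (μ * Real.exp (Q * (s - a))) := by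
        rw [← intervalIntegral.integral_add hi1 hi2]
        simp only [mul_add]
      have h2 : ∫ s in a..t, q s * (μ * Real.exp (Q * (s - a)))
          ≤ ∫ s in a..t, μ * (Real.exp (Q * (s - a)) * Q) * Q := by
        refine intervalIntegral.integral_mono_on ht.1 hi2 hi3 fun s hs => ?_
        have := hqQ s ⟨hs.1, hs.2.trans ht.2⟩
        have hpos : 0 < μ * Real.exp (Q * (s - a)) := by positivity
        nlinarith
      have h3 : ∫ s in a..t, μ * (Real.exp (Q * (s - a)) * Q) * Q
          = μ * Real.exp (Q * (t - a)) * Q - μ * Real.exp (Q * (a - a)) * Q := by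
        refine intervalIntegral.integral_eq_sub_of_hasDerivAt
          (f := fun s => μ * Real.exp (Q * (s - a)) * Q) (fun s _ => (hz s).mul_const Q) hi3
      have h4 := hE t ht
      simp only [h1]
      nlinarith
    · have : 0 < μ * Real.exp (Q * (a - a)) := by positivity
      linarith
    · have : 0 < μ * (Real.exp (Q * (a - a)) * Q) := by positivity
      linarith
  intro t ht
  by_contra! hlt
  have h := key (-D t / Real.exp (Q * (t - a))) (div_pos (by linarith) (Real.exp_pos _)) t ht
  rw [div_mul_cancel₀ _ (Real.exp_pos _).ne'] at h
  linarith

theorem add_sq_le_of_deriv_ge {s t c : ℝ} {y E : ℝ → ℝ} (hst : s ≤ t)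
    (hy : ∀ r ∈ Icc s t, HasDerivWithinAt y (E r) (Icc s t) r)
    (hE : ∀ r ∈ Icc s t, c * (r - s) ≤ E r) :
    y s + c * (t - s) ^ 2 / 2 ≤ y t := by
  have hd : ∀ r, HasDerivAt (fun r => c * (r - s) ^ 2 / 2) (c * (r - s)) r := by
    intro r
    have := ((((hasDerivAt_id r).sub_const s).pow 2).const_mul c).div_const 2
    refine this.congr_deriv ?_
    simp; ring
  have hmono : MonotoneOn (fun r => y r - c * (r - s) ^ 2 / 2) (Icc s t) := by
    refine monotoneOn_of_hasDerivWithinAt_nonneg (f' := fun r => E r - c * (r - s))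
      (convex_Icc s t) ?_ ?_ ?_
    · exact fun r hr => ((hy r hr).sub (hd r).hasDerivWithinAt).continuousWithinAt
    · exact fun r hr => ((hy r (interior_subset hr)).sub (hd r).hasDerivWithinAt).mono
        interior_subset
    · intro r hr
      have := hE r (interior_subset hr)
      linarith
  have := hmono (left_mem_Icc.2 hst) (right_mem_Icc.2 hst) hst
  simp only [sub_self] at this
  linarith

/-- An upper bound for the length of an interval on which `y'' = N ≥ B |y| ^ p` with `y ≥ Y > 0` and
`y' ≥ 0` at the left end. The second derivative enters only through the increments of `E = y'`.
The `k`-th doubling of `y` takes a time proportional to `2 ^ (-k (p - 1) / 2)`, and the bound is the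
sum of this geometric series. -/
theorem length_lt_of_superlinear {a b B p Y : ℝ} {y E N : ℝ → ℝ} (hp : 1 < p) (hB : 0 < B)
    (hY : 0 < Y) (hab : a ≤ b)
    (hy : ∀ r ∈ Icc a b, HasDerivWithinAt y (E r) (Icc a b) r)
    (hN : ∀ s t c, a ≤ s → s ≤ t → t ≤ b → (∀ r ∈ Icc s t, c ≤ N r) → c * (t - s) ≤ E t - E s)
    (hNy : ∀ r ∈ Icc a b, B * |y r| ^ p ≤ N r) (hya : Y ≤ y a) (hEa : 0 ≤ E a) :
    b - a < Real.sqrt (2 / (B * Y ^ (p - 1))) / (1 - (2 : ℝ) ^ (-(p - 1) / 2)) := by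
  set θ : ℝ := (2 : ℝ) ^ (-(p - 1) / 2) with hθ
  set h₀ : ℝ := Real.sqrt (2 / (B * Y ^ (p - 1))) with hh₀
  have hθ0 : 0 < θ := by positivity
  have hθ1 : θ < 1 := Real.rpow_lt_one_of_one_lt_of_neg (by norm_num) (by linarith)
  have hh₀0 : 0 < h₀ := by positivity
  have hE0 : ∀ r ∈ Icc a b, 0 ≤ E r := by
    intro r hr
    have := hN a r 0 le_rfl hr.1 hr.2 fun x hx => le_trans (by positivity)
      (hNy x ⟨hx.1, hx.2.trans hr.2⟩)
    linarith
  have hmono : MonotoneOn y (Icc a b) := by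
    refine monotoneOn_of_hasDerivWithinAt_nonneg (f' := E) (convex_Icc a b)
      (fun r hr => (hy r hr).continuousWithinAt) (fun r hr => (hy r (interior_subset hr)).mono
        interior_subset) fun r hr => hE0 r (interior_subset hr)
  by_contra! hlong
  -- `τ k` is the time by which `y` has doubled `k` times.
  set τ : ℕ → ℝ := fun k => a + h₀ * (1 - θ ^ k) / (1 - θ) with hτ
  have hτs : ∀ k, τ (k + 1) - τ k = h₀ * θ ^ k := by
    intro k
    have : 1 - θ ≠ 0 := by linarith
    simp only [hτ]; field_simp; ring
  have hτa : ∀ k, a ≤ τ k := by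
    intro k
    have h1 : θ ^ k ≤ 1 := pow_le_one₀ hθ0.le hθ1.le
    have h2 : 0 ≤ h₀ * (1 - θ ^ k) / (1 - θ) :=
      div_nonneg (mul_nonneg hh₀0.le (by linarith)) (by linarith)
    simp only [hτ]; linarith
  have hτb : ∀ k, τ k ≤ b := by
    intro k
    have h2 : h₀ * (1 - θ ^ k) / (1 - θ) ≤ h₀ / (1 - θ) := by
      apply div_le_div_of_nonneg_right _ (by linarith)
      have : 0 < θ ^ k := by positivity
      nlinarith
    simp only [hτ]; linarith
  have hgrow : ∀ k : ℕ, 2 ^ k * Y ≤ y (τ k) := by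
    intro k
    induction k with
    | zero => simpa [hτ] using hya
    | succ k ih =>
      have hle : τ k ≤ τ (k + 1) := by
        have := hτs k
        have : 0 < h₀ * θ ^ k := by positivity
        linarith
      have hsub : Icc (τ k) (τ (k + 1)) ⊆ Icc a b := Icc_subset_Icc (hτa k) (hτb _)
      have hYk : 0 < 2 ^ k * Y := by positivity
      have h1 := add_sq_le_of_deriv_ge (c := B * (2 ^ k * Y) ^ p) hle
        (fun r hr => (hy r (hsub hr)).mono hsub) (fun r hr => by
          have h2 := hN (τ k) r (B * (2 ^ k * Y) ^ p) (hτa k) hr.1 (hsub hr).2 fun x hx => by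
            have hx' : x ∈ Icc a b := ⟨(hτa k).trans hx.1, hx.2.trans (hsub hr).2⟩
            refine le_trans ?_ (hNy x hx')
            have h3 : 2 ^ k * Y ≤ |y x| := (ih.trans (hmono ⟨hτa k, hτb k⟩ hx' hx.1)).trans
              (le_abs_self _)
            gcongr
          have h4 := hE0 (τ k) ⟨hτa k, hτb k⟩
          linarith)
      -- The `k`-th step is exactly long enough for one more doubling.
      have h5 : B * (2 ^ k * Y) ^ p * (τ (k + 1) - τ k) ^ 2 / 2 = 2 ^ k * Y := by
        rw [hτs k, mul_pow, hh₀, Real.sq_sqrt (by positivity), ← pow_mul, mul_comm k 2, pow_mul]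
        have h6 : θ ^ 2 = (2 : ℝ) ^ (-(p - 1)) := by
          rw [hθ, ← Real.rpow_natCast, ← Real.rpow_mul (by norm_num)]; congr 1; push_cast; ring
        have h7 : (2 ^ k * Y) ^ p = (2 ^ k * Y) * ((2 ^ k) ^ (p - 1) * Y ^ (p - 1)) := by
          rw [← Real.mul_rpow (by positivity) hY.le, ← Real.rpow_one_add' hYk.le (by linarith)]
          congr 1; ring
        have h8 : (2 : ℝ) ^ (-(p - 1)) = ((2 : ℝ) ^ (p - 1))⁻¹ := Real.rpow_neg (by norm_num) _
        have h9 : ((2 : ℝ) ^ k) ^ (p - 1) = ((2 : ℝ) ^ (p - 1)) ^ k := by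
          rw [← Real.rpow_natCast, ← Real.rpow_natCast, ← Real.rpow_mul (by norm_num),
            ← Real.rpow_mul (by norm_num), mul_comm]
        have hY' : 0 < Y ^ (p - 1) := by positivity
        rw [h6, h7, h8, h9, inv_pow]
        field_simp
      rw [h5] at h1
      rw [pow_succ]
      linarith
  obtain ⟨k, hk⟩ := pow_unbounded_of_one_lt (y b / Y) (by norm_num : (1 : ℝ) < 2)
  rw [div_lt_iff₀ hY] at hk
  have h1 := hgrow k
  have h2 := hmono ⟨hτa k, hτb k⟩ ⟨hab, le_rfl⟩ (hτb k)
  linarith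

/-- The exponent of the subsolution `exp (tricomiExponent m t)` of `v'' = t ^ m v`. Its first two
terms give the asymptotics `t ^ (-m / 4) exp (φ(t))` of the growing solution; the bounded term
`1 / t` turns this into a subsolution for large `t`. -/
noncomputable def tricomiExponent (m t : ℝ) : ℝ := tricomiPhi m t - m / 4 * Real.log t + t⁻¹

/-- The derivative of `tricomiExponent m`. -/
noncomputable def tricomiExponentDeriv (m t : ℝ) : ℝ := t ^ (m / 2) - m / 4 * t⁻¹ - (t ^ 2)⁻¹

theorem hasDerivAt_tricomiPhi {m t : ℝ} (hm : 0 < m) (ht : 0 < t) :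
    HasDerivAt (tricomiPhi m) (t ^ (m / 2)) t := by
  have h := (Real.hasDerivAt_rpow_const (x := t) (p := (m + 2) / 2) (Or.inl ht.ne')).const_mul
    (2 / (m + 2))
  refine h.congr_deriv ?_
  rw [show (m + 2) / 2 - 1 = m / 2 by ring]
  field_simp

theorem hasDerivAt_tricomiExponent {m t : ℝ} (hm : 0 < m) (ht : 0 < t) :
    HasDerivAt (tricomiExponent m) (tricomiExponentDeriv m t) t := by
  have h := ((hasDerivAt_tricomiPhi hm ht).sub ((Real.hasDerivAt_log ht.ne').const_mul (m / 4))).add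
    (hasDerivAt_inv ht.ne')
  refine h.congr_deriv ?_
  simp only [tricomiExponentDeriv]; ring

theorem hasDerivAt_tricomiExponentDeriv {m t : ℝ} (ht : 0 < t) :
    HasDerivAt (tricomiExponentDeriv m)
      (m / 2 * t ^ (m / 2 - 1) + m / 4 * (t ^ 2)⁻¹ + 2 * (t ^ 3)⁻¹) t := by
  have h := ((Real.hasDerivAt_rpow_const (x := t) (p := m / 2) (Or.inl ht.ne')).sub
    ((hasDerivAt_inv ht.ne').const_mul (m / 4))).sub (((hasDerivAt_id t).pow 2).inv (by
      simp [ht.ne']))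
  refine h.congr_deriv ?_
  simp only [id, Pi.pow_apply]
  field_simp
  ring

/-- `exp (tricomiExponent m t)` is a subsolution for large `t`: the term `1 / t` contributes
`-2 t ^ (m / 2 - 2)`, which absorbs the error `(m ^ 2 / 16 + m / 4) / t ^ 2` of the leading terms. -/
theorem tricomiExponent_subsolution {m t : ℝ} (ht : 1 ≤ t)
    (hlarge : m ^ 2 / 16 + m / 4 + m + 3 ≤ 2 * t ^ (m / 2)) (hm : 0 < m) :
    (m / 2 * t ^ (m / 2 - 1) + m / 4 * (t ^ 2)⁻¹ + 2 * (t ^ 3)⁻¹) + tricomiExponentDeriv m t ^ 2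
      ≤ t ^ m := by
  have ht0 : 0 < t := by linarith
  have h1 : t ^ (m / 2 - 1) = t ^ (m / 2) * t⁻¹ := by
    rw [Real.rpow_sub_one ht0.ne', div_eq_mul_inv]
  have h2 : t ^ m = t ^ (m / 2) * t ^ (m / 2) := by
    rw [← Real.rpow_add ht0]; congr 1; ring
  rw [h1, h2, tricomiExponentDeriv]
  set X := t ^ (m / 2)
  have hs1 : t⁻¹ ≤ 1 := inv_le_one_of_one_le₀ ht
  have hs0 : 0 < t⁻¹ := by positivity
  rw [← inv_pow, ← inv_pow]
  set s := t⁻¹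
  have h3 : m / 2 * s + s ^ 2 + 2 * s ≤ m + 3 := by nlinarith
  have h4 : m ^ 2 / 16 + m / 4 + (m / 2 * s + s ^ 2 + 2 * s) ≤ 2 * X := by linarith
  have h5 := mul_le_mul_of_nonneg_left h4 (sq_nonneg s)
  nlinarith

/-- Solutions of `H'' ≥ t ^ m H` with nonnegative data grow at least like
`t ^ (-m / 4) exp (φ(t))`. The inequality is stated in integrated form, with `E = H'`. -/
theorem exists_lower_bound_of_deriv_ge {m : ℝ} (hm : 0 < m) :
    ∃ t₁ δ : ℝ, 2 ≤ t₁ ∧ 0 < δ ∧ ∀ (b A B : ℝ) (H E : ℝ → ℝ), 0 ≤ A → 0 ≤ B →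
      (∀ t ∈ Icc 0 b, HasDerivWithinAt H (E t) (Icc 0 b) t) →
      (∀ s t, 0 ≤ s → s ≤ t → t ≤ b → E s + ∫ r in s..t, r ^ m * H r ≤ E t) →
      A ≤ H 0 → B ≤ E 0 →
      ∀ t ∈ Icc t₁ b, δ * (A + B) * (t ^ (-(m / 4)) * Real.exp (tricomiPhi m t)) ≤ H t := by
  have htend := tendsto_rpow_atTop (y := m / 2) (by linarith)
  obtain ⟨t₂, ht₂⟩ := Filter.eventually_atTop.1
    (htend.eventually_ge_atTop (m ^ 2 / 16 + m / 4 + m + 3))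
  set t₁ := max t₂ 2 with ht₁
  have ht₁2 : 2 ≤ t₁ := le_max_right _ _
  have ht₁0 : 0 < t₁ := by linarith
  have hlarge : ∀ t, t₁ ≤ t → m ^ 2 / 16 + m / 4 + m + 3 ≤ 2 * t ^ (m / 2) := by
    intro t ht
    have h1 := ht₂ t ((le_max_left _ _).trans ht)
    have h2 : 0 ≤ t ^ (m / 2) := Real.rpow_nonneg (by linarith) _
    linarith
  set v : ℝ → ℝ := fun t => Real.exp (tricomiExponent m t) with hv
  set v' : ℝ → ℝ := fun t => v t * tricomiExponentDeriv m t with hv'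
  set σ : ℝ → ℝ := fun t =>
    (m / 2 * t ^ (m / 2 - 1) + m / 4 * (t ^ 2)⁻¹ + 2 * (t ^ 3)⁻¹) + tricomiExponentDeriv m t ^ 2
  have hdv : ∀ t, 0 < t → HasDerivAt v (v' t) t := fun t ht =>
    (hasDerivAt_tricomiExponent hm ht).exp
  have hdv' : ∀ t, 0 < t → HasDerivAt v' (v t * σ t) t := by
    intro t ht
    refine ((hdv t ht).mul (hasDerivAt_tricomiExponentDeriv (m := m) ht)).congr_deriv ?_
    simp only [hv', σ]; ring
  set M : ℝ := v t₁ + |v' t₁| with hM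
  have hM0 : 0 < M := add_pos_of_pos_of_nonneg (Real.exp_pos _) (abs_nonneg _)
  refine ⟨t₁, M⁻¹, ht₁2, inv_pos.2 hM0, ?_⟩
  intro b A B H E hA hB hH hE hHA hEB t ht
  have htb : t₁ ≤ b := ht.1.trans ht.2
  have hq : Continuous (fun r : ℝ => r ^ m) := Real.continuous_rpow_const hm.le
  have hcont : ContinuousOn H (Icc 0 b) := fun t ht => (hH t ht).continuousWithinAt
  have hH0 : ∀ r ∈ Icc 0 b, 0 ≤ H r :=
    nonneg_of_deriv_ge_integral hH hq.continuousOn (fun r hr => Real.rpow_nonneg hr.1 _)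
      (fun r hr => hE 0 r le_rfl hr.1 hr.2) (hA.trans hHA) (hB.trans hEB)
  have hEmono : ∀ s t, 0 ≤ s → s ≤ t → t ≤ b → E s ≤ E t := by
    intro s t hs hst htb
    have h1 := hE s t hs hst htb
    have h2 : 0 ≤ ∫ r in s..t, r ^ m * H r := intervalIntegral.integral_nonneg hst fun r hr =>
      mul_nonneg (Real.rpow_nonneg (hs.trans hr.1) _) (hH0 r ⟨hs.trans hr.1, hr.2.trans htb⟩)
    linarith
  have hlin : ∀ r ∈ Icc 1 b, A + B ≤ H r := by
    intro r hr
    have hr0 : 0 ≤ r := by linarith [hr.1]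
    have hd : ∀ x, HasDerivAt (fun x => B * x) B x := fun x => by
      simpa using (hasDerivAt_id x).const_mul B
    have hmono : MonotoneOn (fun x => H x - B * x) (Icc 0 b) := by
      refine monotoneOn_of_hasDerivWithinAt_nonneg (f' := fun x => E x - B) (convex_Icc 0 b) ?_ ?_ ?_
      · exact fun r hr => ((hH r hr).sub (hd r).hasDerivWithinAt).continuousWithinAt
      · exact fun r hr => ((hH r (interior_subset hr)).sub (hd r).hasDerivWithinAt).mono
          interior_subset
      · intro x hx
        have hx' := interior_subset hx
        have := hEmono 0 x le_rfl hx'.1 hx'.2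
        linarith
    have h1 := hmono ⟨le_rfl, hr0.trans hr.2⟩ ⟨hr0, hr.2⟩ hr0
    simp only [mul_zero, sub_zero] at h1
    nlinarith [hr.1]
  have hE2 : A + B ≤ E t₁ := by
    have h1 := hE 1 2 (by norm_num) (by norm_num) (ht₁2.trans htb)
    have h2 : ∫ _ in (1 : ℝ)..2, (A + B) ≤ ∫ r in (1 : ℝ)..2, r ^ m * H r := by
      refine intervalIntegral.integral_mono_on (by norm_num) (by simp) ?_ ?_
      · refine ContinuousOn.intervalIntegrable (hq.continuousOn.mul (hcont.mono ?_))
        rw [uIcc_of_le (by norm_num)]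
        exact Icc_subset_Icc (by norm_num) (ht₁2.trans htb)
      · intro r hr
        have h3 := hlin r ⟨hr.1, hr.2.trans (ht₁2.trans htb)⟩
        have h4 : 1 ≤ r ^ m := Real.one_le_rpow hr.1 hm.le
        nlinarith
    have h5 : 0 ≤ E 1 := (hB.trans hEB).trans (hEmono 0 1 le_rfl (by norm_num) (by linarith))
    have h6 := hEmono 2 t₁ (by norm_num) ht₁2 htb
    rw [intervalIntegral.integral_const] at h2
    norm_num at h2
    linarith
  have hH2 : A + B ≤ H t₁ := hlin t₁ ⟨by linarith, htb⟩
  set κ : ℝ := M⁻¹ * (A + B) with hκ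
  have hκ0 : 0 ≤ κ := mul_nonneg (inv_pos.2 hM0).le (by linarith)
  have hκM : κ * M = A + B := by rw [hκ]; field_simp
  have hcomp : ∀ r ∈ Icc t₁ b, 0 ≤ H r - κ * v r := by
    refine nonneg_of_deriv_ge_integral (E := fun r => E r - κ * v' r) (q := fun r => r ^ m)
      ?_ hq.continuousOn (fun r hr => Real.rpow_nonneg (ht₁0.le.trans hr.1) _) ?_ ?_ ?_
    · intro r hr
      have hsub : Icc t₁ b ⊆ Icc 0 b := Icc_subset_Icc_left ht₁0.le
      exact ((hH r (hsub hr)).mono hsub).sub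
        ((hdv r (ht₁0.trans_le hr.1)).const_mul κ).hasDerivWithinAt
    · intro r hr
      have hpos : ∀ x ∈ uIcc t₁ r, 0 < x := by
        intro x hx
        rw [uIcc_of_le hr.1] at hx
        exact ht₁0.trans_le hx.1
      have hcv : ContinuousOn v (uIcc t₁ r) := fun x hx =>
        (hdv x (hpos x hx)).continuousAt.continuousWithinAt
      have hi1 : IntervalIntegrable (fun x => x ^ m * H x) volume t₁ r := by
        refine ContinuousOn.intervalIntegrable (hq.continuousOn.mul (hcont.mono ?_))
        rw [uIcc_of_le hr.1]
        exact Icc_subset_Icc ht₁0.le hr.2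
      have hi2 : IntervalIntegrable (fun x => x ^ m * v x) volume t₁ r :=
        (hq.continuousOn.mul hcv).intervalIntegrable
      have h1 : ∫ x in t₁..r, x ^ m * (H x - κ * v x)
          = (∫ x in t₁..r, x ^ m * H x) - κ * ∫ x in t₁..r, x ^ m * v x := by
        rw [← intervalIntegral.integral_const_mul, ← intervalIntegral.integral_sub hi1
          (hi2.const_mul κ)]
        congr 1; ext x; ring
      have hcσ : ContinuousOn (fun x => v x * σ x) (uIcc t₁ r) := by
        refine hcv.mul (ContinuousOn.add ?_ ?_)
        · refine ContinuousOn.add (ContinuousOn.add ?_ ?_) ?_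
          · exact continuousOn_const.mul (continuousOn_id.rpow_const fun x hx =>
              Or.inl (hpos x hx).ne')
          · exact continuousOn_const.mul ((continuousOn_id.pow 2).inv₀ fun x hx =>
              (pow_pos (hpos x hx) 2).ne')
          · exact continuousOn_const.mul ((continuousOn_id.pow 3).inv₀ fun x hx =>
              (pow_pos (hpos x hx) 3).ne')
        · exact ContinuousOn.pow (fun x hx => (hasDerivAt_tricomiExponentDeriv
            (hpos x hx)).continuousAt.continuousWithinAt) 2
      have h2 : ∫ x in t₁..r, v x * σ x = v' r - v' t₁ :=
        intervalIntegral.integral_eq_sub_of_hasDerivAt (fun x hx => hdv' x (hpos x hx))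
          hcσ.intervalIntegrable
      have h3 : ∫ x in t₁..r, v x * σ x ≤ ∫ x in t₁..r, x ^ m * v x := by
        refine intervalIntegral.integral_mono_on hr.1 hcσ.intervalIntegrable hi2 fun x hx => ?_
        rw [mul_comm]
        exact mul_le_mul_of_nonneg_right (tricomiExponent_subsolution (by linarith [hx.1])
          (hlarge x hx.1) hm) (Real.exp_pos _).le
      have h4 := hE t₁ r ht₁0.le hr.1 hr.2
      have h5 := mul_le_mul_of_nonneg_left h3 hκ0
      rw [h2] at h5
      simp only [h1]
      linarith
    · have : κ * v t₁ ≤ κ * M := by gcongr; exact le_add_of_nonneg_right (abs_nonneg _)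
      linarith
    · have h1 : v' t₁ ≤ M := (le_abs_self _).trans (le_add_of_nonneg_left (Real.exp_pos _).le)
      have : κ * v' t₁ ≤ κ * M := by gcongr
      linarith
  have h1 := hcomp t ht
  have ht0 : 0 < t := ht₁0.trans_le ht.1
  have h2 : t ^ (-(m / 4)) * Real.exp (tricomiPhi m t) ≤ v t := by
    rw [Real.rpow_def_of_pos ht0, ← Real.exp_add]
    apply Real.exp_le_exp.2
    have : 0 < t⁻¹ := by positivity
    simp only [tricomiExponent]
    linarith
  have h3 := mul_le_mul_of_nonneg_left h2 hκ0
  linarith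

/-! ### Spherical averages of exponentials -/

/-- A Gaussian integral over the unit ball in the squared distance to the line through `e`. In an
orthonormal basis starting with `e` it is bounded by a product of `n - 1` Gaussian integrals and the
length of `[-1, 1]`. -/
theorem lintegral_exp_neg_dist_line_le {n : ℕ} (e : EuclideanSpace ℝ (Fin n)) (he : ‖e‖ = 1)
    {a : ℝ} (ha : 0 < a) :
    ∫⁻ y in Metric.closedBall (0 : EuclideanSpace ℝ (Fin n)) 1,
        ENNReal.ofReal (Real.exp (-(a * (‖y‖ ^ 2 - inner ℝ e y ^ 2))))
      ≤ ENNReal.ofReal (2 * (Real.pi / a) ^ (((n : ℝ) - 1) / 2)) := by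
  classical
  have hn : n ≠ 0 := by
    rintro rfl
    rw [Subsingleton.elim e 0] at he
    simp at he
  have : NeZero n := ⟨hn⟩
  obtain ⟨b, hb⟩ := Orthonormal.exists_orthonormalBasis_extension_of_card_eq (𝕜 := ℝ)
    (E := EuclideanSpace ℝ (Fin n)) (ι := Fin n) (by simp) (v := fun _ => e) (s := {0}) (by
      rw [orthonormal_iff_ite]
      rintro ⟨i, hi⟩ ⟨j, hj⟩
      simp only [mem_singleton_iff] at hi hj
      subst hi; subst hj
      simp [domRestrict, he])
  have hb0 : b 0 = e := hb 0 rfl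
  set f : Fin n → ℝ → ℝ := fun i => if i = 0 then (Icc (-1 : ℝ) 1).indicator (fun _ => 1)
    else fun s => Real.exp (-a * s ^ 2) with hf
  have hf0 : ∀ i s, 0 ≤ f i s := by
    intro i s
    simp only [hf]
    split_ifs
    · exact indicator_nonneg (fun _ _ => zero_le_one) _
    · positivity
  have hfint : ∀ i, Integrable (f i) volume := by
    intro i
    simp only [hf]
    split_ifs
    · exact (integrable_indicator_iff measurableSet_Icc).2 (by simp)
    · exact integrable_exp_neg_mul_sq ha
  have hprod : Integrable (fun z : Fin n → ℝ => ∏ i, f i (z i)) volume :=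
    Integrable.fintype_prod_dep hfint
  have hmp : MeasurePreserving (fun y : EuclideanSpace ℝ (Fin n) => WithLp.ofLp (b.repr y)) :=
    (PiLp.volume_preserving_ofLp (Fin n)).comp b.measurePreserving_repr
  have hval : ∏ i, ∫ s, f i s = 2 * (Real.pi / a) ^ (((n : ℝ) - 1) / 2) := by
    rw [← Finset.mul_prod_erase Finset.univ _ (Finset.mem_univ (0 : Fin n))]
    have h1 : ∫ s, f 0 s = 2 := by
      simp only [hf, if_true]
      rw [integral_indicator measurableSet_Icc]
      simp
      norm_num
    have h2 : ∏ i ∈ Finset.univ.erase (0 : Fin n), ∫ s, f i s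
        = ∏ i ∈ Finset.univ.erase (0 : Fin n), (Real.pi / a) ^ ((1 : ℝ) / 2) := by
      refine Finset.prod_congr rfl fun i hi => ?_
      simp only [hf, if_neg (Finset.ne_of_mem_erase hi)]
      rw [integral_gaussian, Real.sqrt_eq_rpow]
    rw [h1, h2, Finset.prod_const, Finset.card_erase_of_mem (Finset.mem_univ _), Finset.card_univ,
      Fintype.card_fin, ← Real.rpow_natCast, ← Real.rpow_mul (by positivity),
      Nat.cast_sub (Nat.one_le_iff_ne_zero.2 hn)]
    congr 2
    push_cast; ring
  calc ∫⁻ y in Metric.closedBall (0 : EuclideanSpace ℝ (Fin n)) 1,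
        ENNReal.ofReal (Real.exp (-(a * (‖y‖ ^ 2 - inner ℝ e y ^ 2))))
      ≤ ∫⁻ y in Metric.closedBall (0 : EuclideanSpace ℝ (Fin n)) 1,
          ENNReal.ofReal (∏ i, f i (b.repr y i)) := by
        refine setLIntegral_mono' Metric.isClosed_closedBall.measurableSet fun y hy => ?_
        apply ENNReal.ofReal_le_ofReal
        rw [← Finset.mul_prod_erase Finset.univ _ (Finset.mem_univ (0 : Fin n))]
        have hy1 : ‖y‖ ≤ 1 := by simpa using hy
        have h1 : f 0 (b.repr y 0) = 1 := by
          simp only [hf, if_true]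
          rw [indicator_of_mem]
          rw [b.repr_apply_apply, hb0, mem_Icc, ← abs_le]
          calc |inner ℝ e y| ≤ ‖e‖ * ‖y‖ := abs_real_inner_le_norm e y
            _ ≤ 1 := by rw [he, one_mul]; exact hy1
        have h2 : ∏ i ∈ Finset.univ.erase (0 : Fin n), f i (b.repr y i)
            = ∏ i ∈ Finset.univ.erase (0 : Fin n), Real.exp (-a * inner ℝ (b i) y ^ 2) := by
          refine Finset.prod_congr rfl fun i hi => ?_
          simp only [hf, if_neg (Finset.ne_of_mem_erase hi), b.repr_apply_apply]
        rw [h1, h2, one_mul, ← Real.exp_sum, ← Finset.mul_sum]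
        apply le_of_eq
        congr 1
        have h3 := b.sum_sq_norm_inner_right y
        rw [← Finset.add_sum_erase Finset.univ _ (Finset.mem_univ (0 : Fin n)), hb0] at h3
        simp only [Real.norm_eq_abs, sq_abs] at h3
        rw [← h3]; ring
    _ ≤ ∫⁻ y : EuclideanSpace ℝ (Fin n), ENNReal.ofReal (∏ i, f i (b.repr y i)) :=
        setLIntegral_le_lintegral _ _
    _ = ∫⁻ z : Fin n → ℝ, ENNReal.ofReal (∏ i, f i (z i)) := by
        refine hmp.lintegral_comp_emb ?_ (fun z : Fin n → ℝ => ENNReal.ofReal (∏ i, f i (z i)))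
        exact (MeasurableEquiv.toLp 2 (Fin n → ℝ)).symm.measurableEmbedding.comp
          b.repr.toHomeomorph.measurableEmbedding
    _ = ENNReal.ofReal (∫ z : Fin n → ℝ, ∏ i, f i (z i)) :=
        (ofReal_integral_eq_lintegral_ofReal hprod
          (Filter.Eventually.of_forall fun z => Finset.prod_nonneg fun i _ => hf0 i _)).symm
    _ = ENNReal.ofReal (2 * (Real.pi / a) ^ (((n : ℝ) - 1) / 2)) := by
        rw [integral_fintype_prod_volume_eq_prod, hval]

/-- The average of `exp ⟪x, ω⟫` over directions `ω` is at most of the order of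
`exp ‖x‖ * ‖x‖ ^ (-(n - 1) / 2)`. Directions are sampled as `ω = y / ‖y‖` with `y` uniform in the
unit ball. -/
theorem exists_lintegral_exp_inner_le (n : ℕ) (hn : 1 ≤ n) :
    ∃ C : ℝ, 0 < C ∧ ∀ x : EuclideanSpace ℝ (Fin n),
      ∫⁻ y in Metric.closedBall (0 : EuclideanSpace ℝ (Fin n)) 1,
          ENNReal.ofReal (Real.exp (inner ℝ x (‖y‖⁻¹ • y)))
        ≤ ENNReal.ofReal (C * (Real.exp ‖x‖ * (1 + ‖x‖) ^ (-(((n : ℝ) - 1) / 2)))) := by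
  have : NeZero n := ⟨by omega⟩
  refine ⟨Real.exp (1 / 2) * (2 * (2 * Real.pi) ^ (((n : ℝ) - 1) / 2)), by positivity, fun x => ?_⟩
  obtain ⟨e, he, hxe⟩ : ∃ e : EuclideanSpace ℝ (Fin n), ‖e‖ = 1 ∧ x = ‖x‖ • e := by
    by_cases hx : x = 0
    · exact ⟨EuclideanSpace.single 0 1, by simp, by simp [hx]⟩
    · have : ‖x‖ ≠ 0 := norm_ne_zero_iff.2 hx
      exact ⟨‖x‖⁻¹ • x, by rw [norm_smul, norm_inv, norm_norm, inv_mul_cancel₀ this],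
        by rw [smul_smul, mul_inv_cancel₀ this, one_smul]⟩
  set r := ‖x‖ with hr
  have hr0 : 0 ≤ r := norm_nonneg x
  have ha : 0 < (1 + r) / 2 := by positivity
  -- `1 - ⟪e, ω⟫ ≥ (1 - ⟪e, ω⟫ ^ 2) / 2`, and the right side bounds half the squared distance from
  -- `y` to the line through `e`.
  have hpt : ∀ y : EuclideanSpace ℝ (Fin n), ‖y‖ ≤ 1 →
      inner ℝ x (‖y‖⁻¹ • y) ≤ r + 1 / 2 + -((1 + r) / 2 * (‖y‖ ^ 2 - inner ℝ e y ^ 2)) := by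
    intro y hy
    rw [hxe, real_inner_smul_left, real_inner_smul_right]
    by_cases hy0 : y = 0
    · simp [hy0]; positivity
    have hyp : 0 < ‖y‖ := norm_pos_iff.2 hy0
    obtain ⟨s, hs⟩ : ∃ s, s = ‖y‖⁻¹ * inner ℝ e y := ⟨_, rfl⟩
    have hs' : inner ℝ e y = ‖y‖ * s := by rw [hs]; field_simp
    have habs : |inner ℝ e y| ≤ ‖y‖ := by
      simpa [he] using abs_real_inner_le_norm e y
    have hs1 : |s| ≤ 1 := by
      rw [hs, abs_mul, abs_inv, abs_norm, inv_mul_le_iff₀ hyp]; simpa using habs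
    rw [← hs, hs']
    have hs2 := abs_le.1 hs1
    have hq : ‖y‖ ^ 2 - (‖y‖ * s) ^ 2 = ‖y‖ ^ 2 * (1 - s ^ 2) := by ring
    rw [hq]
    have h1 : 0 ≤ 1 - s ^ 2 := by nlinarith
    have h2 : ‖y‖ ^ 2 ≤ 1 := by nlinarith
    have h3 : ‖y‖ ^ 2 * (1 - s ^ 2) ≤ 1 - s ^ 2 := by nlinarith
    have h4 : ‖y‖ ^ 2 * (1 - s ^ 2) ≤ 1 := by nlinarith [sq_nonneg s]
    have h5 : s ≤ 1 - (‖y‖ ^ 2 * (1 - s ^ 2)) / 2 := by nlinarith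
    nlinarith [mul_le_mul_of_nonneg_left h5 hr0]
  calc ∫⁻ y in Metric.closedBall (0 : EuclideanSpace ℝ (Fin n)) 1,
          ENNReal.ofReal (Real.exp (inner ℝ x (‖y‖⁻¹ • y)))
      ≤ ∫⁻ y in Metric.closedBall (0 : EuclideanSpace ℝ (Fin n)) 1,
          ENNReal.ofReal (Real.exp (r + 1 / 2)) *
            ENNReal.ofReal (Real.exp (-((1 + r) / 2 * (‖y‖ ^ 2 - inner ℝ e y ^ 2)))) := by
        refine setLIntegral_mono' Metric.isClosed_closedBall.measurableSet fun y hy => ?_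
        rw [← ENNReal.ofReal_mul (Real.exp_pos _).le, ← Real.exp_add]
        exact ENNReal.ofReal_le_ofReal (Real.exp_le_exp.2 (hpt y (by simpa using hy)))
    _ = ENNReal.ofReal (Real.exp (r + 1 / 2)) *
          ∫⁻ y in Metric.closedBall (0 : EuclideanSpace ℝ (Fin n)) 1,
            ENNReal.ofReal (Real.exp (-((1 + r) / 2 * (‖y‖ ^ 2 - inner ℝ e y ^ 2)))) :=
        lintegral_const_mul' _ _ ENNReal.ofReal_ne_top
    _ ≤ ENNReal.ofReal (Real.exp (r + 1 / 2)) *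
          ENNReal.ofReal (2 * (Real.pi / ((1 + r) / 2)) ^ (((n : ℝ) - 1) / 2)) := by
        gcongr
        exact lintegral_exp_neg_dist_line_le e he ha
    _ = _ := by
        rw [← ENNReal.ofReal_mul (Real.exp_pos _).le]
        congr 1
        have h1 : Real.pi / ((1 + r) / 2) = 2 * Real.pi * (1 + r)⁻¹ := by field_simp
        rw [h1, Real.mul_rpow (by positivity) (by positivity), Real.inv_rpow (by positivity),
          ← Real.rpow_neg (by positivity), Real.exp_add]
        ring

/-- Powers of `1 + r` vary slower than exponentials, whatever the sign of the exponent. -/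
theorem exists_one_add_rpow_le (β : ℝ) {q : ℝ} (hq : 0 < q) :
    ∃ K : ℝ, 0 < K ∧ ∀ r ρ : ℝ, 0 ≤ r → r ≤ ρ →
      (1 + r) ^ β ≤ K * (1 + ρ) ^ β * Real.exp (q * (ρ - r)) := by
  set c := q / (|β| + 1) with hc
  have hβ : 0 ≤ |β| := abs_nonneg β
  have hc0 : 0 < c := by positivity
  refine ⟨(1 + 1 / c) ^ |β|, by positivity, fun r ρ hr hρ => ?_⟩
  have hs : 0 ≤ ρ - r := by linarith
  have h1 : 1 + (ρ - r) ≤ (1 + 1 / c) * Real.exp (c * (ρ - r)) := by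
    have h2 := Real.add_one_le_exp (c * (ρ - r))
    have h3 : (1 + 1 / c) * (c * (ρ - r) + 1) ≤ (1 + 1 / c) * Real.exp (c * (ρ - r)) := by gcongr
    have h4 : (1 + 1 / c) * (c * (ρ - r) + 1) = 1 + (ρ - r) + (c * (ρ - r) + 1 / c) := by
      field_simp; ring
    have h5 : 0 ≤ c * (ρ - r) + 1 / c := by positivity
    linarith
  have h2 : (1 + (ρ - r)) ^ |β| ≤ (1 + 1 / c) ^ |β| * Real.exp (q * (ρ - r)) := by
    calc (1 + (ρ - r)) ^ |β| ≤ ((1 + 1 / c) * Real.exp (c * (ρ - r))) ^ |β| := by gcongr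
      _ = (1 + 1 / c) ^ |β| * Real.exp (c * (ρ - r) * |β|) := by
          rw [Real.mul_rpow (by positivity) (Real.exp_pos _).le, ← Real.exp_mul]
      _ ≤ _ := by
          refine mul_le_mul_of_nonneg_left (Real.exp_le_exp.2 ?_) (by positivity)
          have h6 : c * |β| ≤ q := by
            rw [hc, div_mul_eq_mul_div, div_le_iff₀ (by positivity)]; nlinarith
          calc c * (ρ - r) * |β| = c * |β| * (ρ - r) := by ring
            _ ≤ q * (ρ - r) := by gcongr
  have h3 : (1 + r) ^ β ≤ (1 + ρ) ^ β * (1 + (ρ - r)) ^ |β| := by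
    rcases le_total 0 β with h | h
    · rw [abs_of_nonneg h]
      have h4 : (1 + r) ^ β ≤ (1 + ρ) ^ β := by gcongr
      have h5 : 1 ≤ (1 + (ρ - r)) ^ β := Real.one_le_rpow (by linarith) h
      have h6 : 0 ≤ (1 + ρ) ^ β := Real.rpow_nonneg (by linarith) _
      nlinarith
    · have hρ1 : 0 < 1 + ρ := by linarith
      have hr1 : 0 < 1 + r := by linarith
      have h4 : 1 + ρ ≤ (1 + r) * (1 + (ρ - r)) := by nlinarith
      have h5 : (1 + ρ) ^ (-β) ≤ ((1 + r) * (1 + (ρ - r))) ^ (-β) :=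
        Real.rpow_le_rpow hρ1.le h4 (by linarith)
      rw [Real.mul_rpow hr1.le (by linarith), Real.rpow_neg hρ1.le, Real.rpow_neg hr1.le] at h5
      rw [abs_of_nonpos h]
      have h6 : 0 < (1 + r) ^ β := by positivity
      have h7 : 0 < (1 + ρ) ^ β := by positivity
      rw [inv_le_iff_one_le_mul₀ h7] at h5
      rw [← div_le_iff₀' h7, div_eq_mul_inv]
      have := mul_le_mul_of_nonneg_left h5 h6.le
      field_simp at this ⊢
      linarith
  calc (1 + r) ^ β ≤ (1 + ρ) ^ β * (1 + (ρ - r)) ^ |β| := h3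
    _ ≤ (1 + ρ) ^ β * ((1 + 1 / c) ^ |β| * Real.exp (q * (ρ - r))) := by
        gcongr
        exact Real.rpow_nonneg (by linarith) _
    _ = _ := by ring

/-- In polar coordinates the weight cancels the Jacobian `r ^ (n - 1)`. -/
theorem exists_lintegral_closedBall_exp_le (n : ℕ) (hn : 1 ≤ n) {q : ℝ} (hq : 0 < q) :
    ∃ C : ℝ, 0 < C ∧ ∀ ρ : ℝ, 0 ≤ ρ →
      ∫⁻ x in Metric.closedBall (0 : EuclideanSpace ℝ (Fin n)) ρ,
          ENNReal.ofReal (Real.exp (q * ‖x‖) * (1 + ‖x‖) ^ (-((n : ℝ) - 1)))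
        ≤ ENNReal.ofReal (C * Real.exp (q * ρ)) := by
  have : NeZero n := ⟨by omega⟩
  have : Nontrivial (EuclideanSpace ℝ (Fin n)) := by
    refine ⟨⟨EuclideanSpace.single 0 1, 0, fun h => ?_⟩⟩
    have := congrArg norm h
    simp at this
  set V : ℝ := volume.real (Metric.ball (0 : EuclideanSpace ℝ (Fin n)) 1) with hV
  have hV0 : 0 ≤ V := measureReal_nonneg
  refine ⟨n * V / q + 1, by positivity, fun ρ hρ => ?_⟩
  set f : ℝ → ℝ := fun r => Real.exp (q * r) * (1 + r) ^ (-((n : ℝ) - 1)) with hf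
  have hcf : ContinuousOn f (Ici 0) := by
    refine ContinuousOn.mul (by fun_prop) (ContinuousOn.rpow_const (by fun_prop) fun x hx => ?_)
    have : (0 : ℝ) ≤ x := hx
    exact Or.inl (by positivity)
  have hint : IntegrableOn (fun x : EuclideanSpace ℝ (Fin n) => f ‖x‖)
      (Metric.closedBall 0 ρ) := by
    refine ContinuousOn.integrableOn_compact (isCompact_closedBall 0 ρ) ?_
    exact hcf.comp continuous_norm.continuousOn fun x _ => norm_nonneg x
  rw [← ofReal_integral_eq_lintegral_ofReal hint (Filter.Eventually.of_forall fun x => by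
    simp only [hf, Pi.zero_apply]; positivity)]
  apply ENNReal.ofReal_le_ofReal
  have h1 : ∫ x in Metric.closedBall (0 : EuclideanSpace ℝ (Fin n)) ρ, f ‖x‖
      = ∫ x : EuclideanSpace ℝ (Fin n), (Iic ρ).indicator f ‖x‖ := by
    rw [← integral_indicator Metric.isClosed_closedBall.measurableSet]
    congr 1; ext x
    by_cases hx : ‖x‖ ≤ ρ
    · rw [indicator_of_mem (mem_closedBall_zero_iff.2 hx), indicator_of_mem (mem_Iic.2 hx)]
    · rw [indicator_of_notMem (mt mem_closedBall_zero_iff.1 hx),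
        indicator_of_notMem (mt mem_Iic.1 hx)]
  rw [h1, integral_fun_norm_addHaar, finrank_euclideanSpace, Fintype.card_fin]
  have h2 : ∫ y in Ioi (0 : ℝ), y ^ (n - 1) • (Iic ρ).indicator f y
      ≤ Real.exp (q * ρ) / q := by
    have h3 : ∀ y, y ^ (n - 1) • (Iic ρ).indicator f y
        = (Iic ρ).indicator (fun y => y ^ (n - 1) * f y) y := by
      intro y; by_cases hy : y ∈ Iic ρ <;> simp [indicator_apply]
    simp only [h3]
    rw [setIntegral_indicator measurableSet_Iic, Ioi_inter_Iic,
      ← intervalIntegral.integral_of_le hρ]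
    have h4 : ∫ y in (0 : ℝ)..ρ, Real.exp (q * y) = Real.exp (q * ρ) / q - Real.exp (q * 0) / q := by
      refine intervalIntegral.integral_eq_sub_of_hasDerivAt
        (f := fun y => Real.exp (q * y) / q) (fun y _ => ?_)
        (Continuous.intervalIntegrable (by fun_prop) _ _)
      have h5 : HasDerivAt (fun y => q * y) q y := by simpa using (hasDerivAt_id y).const_mul q
      refine (h5.exp.div_const q).congr_deriv ?_
      field_simp
    have h6 : ∫ y in (0 : ℝ)..ρ, y ^ (n - 1) * f y ≤ ∫ y in (0 : ℝ)..ρ, Real.exp (q * y) := by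
      refine intervalIntegral.integral_mono_on hρ ?_
        (Continuous.intervalIntegrable (by fun_prop) _ _) fun y hy => ?_
      · refine ContinuousOn.intervalIntegrable (ContinuousOn.mul (by fun_prop) (hcf.mono ?_))
        rw [uIcc_of_le hρ]; exact Icc_subset_Ici_self
      · have hy1 : 0 < 1 + y := by linarith [hy.1]
        have h7 : y ^ (n - 1) ≤ (1 + y) ^ ((n : ℝ) - 1) := by
          have h8 : ((n : ℝ) - 1) = ((n - 1 : ℕ) : ℝ) := by rw [Nat.cast_sub hn]; simp
          rw [h8, Real.rpow_natCast]
          exact pow_le_pow_left₀ hy.1 (by linarith) _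
        simp only [hf]
        rw [Real.rpow_neg hy1.le]
        have h9 : 0 < (1 + y) ^ ((n : ℝ) - 1) := by positivity
        rw [mul_comm (Real.exp _), ← mul_assoc]
        have h10 : y ^ (n - 1) * ((1 + y) ^ ((n : ℝ) - 1))⁻¹ ≤ 1 := by
          rw [← div_eq_mul_inv, div_le_one h9]; exact h7
        have := Real.exp_pos (q * y)
        nlinarith
    have h11 : 0 < Real.exp (q * 0) / q := by positivity
    linarith
  have h12 : (0 : ℝ) ≤ n * V := by positivity
  rw [nsmul_eq_mul, smul_eq_mul, ← mul_assoc]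
  calc (n : ℝ) * V * ∫ y in Ioi (0 : ℝ), y ^ (n - 1) • (Iic ρ).indicator f y
      ≤ n * V * (Real.exp (q * ρ) / q) := by gcongr
    _ ≤ (n * V / q + 1) * Real.exp (q * ρ) := by
        have := Real.exp_pos (q * ρ)
        rw [add_mul, mul_div_assoc', div_mul_eq_mul_div]
        linarith

/-- The integral over a ball of the `q`-th power of the bound in `exists_lintegral_exp_inner_le`.
It concentrates near the boundary of the ball, where the power of `1 + ‖x‖` is nearly constant. -/
theorem exists_lintegral_closedBall_rpow_le (n : ℕ) (hn : 1 ≤ n) {q : ℝ} (hq : 0 < q) :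
    ∃ C : ℝ, 0 < C ∧ ∀ ρ : ℝ, 0 ≤ ρ →
      ∫⁻ x in Metric.closedBall (0 : EuclideanSpace ℝ (Fin n)) ρ,
          ENNReal.ofReal (Real.exp ‖x‖ * (1 + ‖x‖) ^ (-(((n : ℝ) - 1) / 2))) ^ q
        ≤ ENNReal.ofReal (C * (Real.exp (q * ρ) * (1 + ρ) ^ (((n : ℝ) - 1) * (1 - q / 2)))) := by
  have hq2 : 0 < q / 2 := by positivity
  obtain ⟨K, hK0, hK⟩ := exists_one_add_rpow_le (((n : ℝ) - 1) * (1 - q / 2)) hq2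
  obtain ⟨C, hC0, hC⟩ := exists_lintegral_closedBall_exp_le n hn hq2
  refine ⟨K * C, by positivity, fun ρ hρ => ?_⟩
  set β := ((n : ℝ) - 1) * (1 - q / 2) with hβ
  have hρ1 : 0 < 1 + ρ := by linarith
  calc ∫⁻ x in Metric.closedBall (0 : EuclideanSpace ℝ (Fin n)) ρ,
          ENNReal.ofReal (Real.exp ‖x‖ * (1 + ‖x‖) ^ (-(((n : ℝ) - 1) / 2))) ^ q
      ≤ ∫⁻ x in Metric.closedBall (0 : EuclideanSpace ℝ (Fin n)) ρ,
          ENNReal.ofReal (K * (1 + ρ) ^ β * Real.exp (q / 2 * ρ)) *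
          ENNReal.ofReal (Real.exp (q / 2 * ‖x‖) * (1 + ‖x‖) ^ (-((n : ℝ) - 1))) := by
        refine setLIntegral_mono' Metric.isClosed_closedBall.measurableSet fun x hx => ?_
        have hx' : ‖x‖ ≤ ρ := by simpa using hx
        have hx1 : 0 < 1 + ‖x‖ := by positivity
        rw [ENNReal.ofReal_rpow_of_nonneg (by positivity) hq.le,
          ← ENNReal.ofReal_mul (by positivity)]
        apply ENNReal.ofReal_le_ofReal
        rw [Real.mul_rpow (Real.exp_pos _).le (by positivity), ← Real.exp_mul,
          ← Real.rpow_mul hx1.le]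
        have h1 : (1 + ‖x‖) ^ (-(((n : ℝ) - 1) / 2) * q)
            = (1 + ‖x‖) ^ β * (1 + ‖x‖) ^ (-((n : ℝ) - 1)) := by
          rw [← Real.rpow_add hx1]; congr 1; rw [hβ]; ring
        rw [h1]
        have h2 := hK ‖x‖ ρ (norm_nonneg x) hx'
        have h3 : Real.exp (‖x‖ * q) = Real.exp (q / 2 * ‖x‖) * Real.exp (q / 2 * ‖x‖) := by
          rw [← Real.exp_add]; congr 1; ring
        have h4 : Real.exp (q / 2 * ρ) = Real.exp (q / 2 * (ρ - ‖x‖)) * Real.exp (q / 2 * ‖x‖) := by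
          rw [← Real.exp_add]; congr 1; ring
        rw [h3, h4]
        calc Real.exp (q / 2 * ‖x‖) * Real.exp (q / 2 * ‖x‖) *
              ((1 + ‖x‖) ^ β * (1 + ‖x‖) ^ (-((n : ℝ) - 1)))
            ≤ Real.exp (q / 2 * ‖x‖) * Real.exp (q / 2 * ‖x‖) *
              (K * (1 + ρ) ^ β * Real.exp (q / 2 * (ρ - ‖x‖)) * (1 + ‖x‖) ^ (-((n : ℝ) - 1))) := by
              gcongr
          _ = _ := by ring
    _ = ENNReal.ofReal (K * (1 + ρ) ^ β * Real.exp (q / 2 * ρ)) *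
          ∫⁻ x in Metric.closedBall (0 : EuclideanSpace ℝ (Fin n)) ρ,
          ENNReal.ofReal (Real.exp (q / 2 * ‖x‖) * (1 + ‖x‖) ^ (-((n : ℝ) - 1))) :=
        lintegral_const_mul' _ _ ENNReal.ofReal_ne_top
    _ ≤ ENNReal.ofReal (K * (1 + ρ) ^ β * Real.exp (q / 2 * ρ)) *
          ENNReal.ofReal (C * Real.exp (q / 2 * ρ)) := by
        gcongr
        exact hC ρ hρ
    _ = _ := by
        rw [← ENNReal.ofReal_mul (by positivity)]
        congr 1
        have h4 : Real.exp (q * ρ) = Real.exp (q / 2 * ρ) * Real.exp (q / 2 * ρ) := by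
          rw [← Real.exp_add]; congr 1; ring
        rw [h4]; ring

/-! ### Testing the weak equation with functions of the space variable -/

/-- The Laplacian of `η`, as the sum of the pure second derivatives along the standard basis. -/
noncomputable def coordLaplacian {n : ℕ} (η : EuclideanSpace ℝ (Fin n) → ℝ)
    (x : EuclideanSpace ℝ (Fin n)) : ℝ :=
  ∑ i, fderiv ℝ (fun y => fderiv ℝ η y (EuclideanSpace.single i 1)) x (EuclideanSpace.single i 1)

theorem contDiff_fderiv_apply {E : Type*} [NormedAddCommGroup E] [NormedSpace ℝ E]
    {η : E → ℝ} (hη : ContDiff ℝ ∞ η) (v : E) :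
    ContDiff ℝ ∞ (fun y => fderiv ℝ η y v) :=
  (hη.fderiv_right (m := ∞) (by simp)).clm_apply contDiff_const

theorem hasCompactSupport_fderiv_coord {n : ℕ} {η : EuclideanSpace ℝ (Fin n) → ℝ}
    (hc : HasCompactSupport η) (v : EuclideanSpace ℝ (Fin n)) :
    HasCompactSupport (fun y => fderiv ℝ η y v) :=
  hc.fderiv_apply (𝕜 := ℝ) v

theorem coordLaplacian_congr {n : ℕ} {η θ : EuclideanSpace ℝ (Fin n) → ℝ}
    {x : EuclideanSpace ℝ (Fin n)} (h : η =ᶠ[nhds x] θ) :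
    coordLaplacian η x = coordLaplacian θ x := by
  refine Finset.sum_congr rfl fun i _ => ?_
  have h1 : (fun y => fderiv ℝ η y (EuclideanSpace.single i (1 : ℝ)))
      =ᶠ[nhds x] fun y => fderiv ℝ θ y (EuclideanSpace.single i 1) := by
    filter_upwards [h.eventuallyEq_nhds] with y hy
    rw [hy.fderiv_eq]
  rw [h1.fderiv_eq]

theorem coordLaplacian_one {n : ℕ} (x : EuclideanSpace ℝ (Fin n)) :
    coordLaplacian (fun _ => (1 : ℝ)) x = 0 := by
  simp [coordLaplacian]

theorem coordLaplacian_exp_inner {n : ℕ} {ξ : EuclideanSpace ℝ (Fin n)} (hξ : ‖ξ‖ = 1)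
    (x : EuclideanSpace ℝ (Fin n)) :
    coordLaplacian (fun y => Real.exp (inner ℝ y ξ)) x = Real.exp (inner ℝ x ξ) := by
  have h1 : ∀ (c : ℝ) (v y : EuclideanSpace ℝ (Fin n)),
      fderiv ℝ (fun y : EuclideanSpace ℝ (Fin n) => Real.exp (inner ℝ y ξ) * c) y v
        = Real.exp (inner ℝ y ξ) * inner ℝ v ξ * c := by
    intro c v y
    have h2 : HasFDerivAt (fun y : EuclideanSpace ℝ (Fin n) => inner ℝ y ξ)
        (innerSL ℝ ξ) y := by
      have := (innerSL ℝ ξ).hasFDerivAt (x := y)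
      refine this.congr_of_eventuallyEq (Filter.Eventually.of_forall fun z => ?_)
      simp [real_inner_comm]
    have h3 := (h2.exp.mul_const c).fderiv
    rw [h3]
    simp [real_inner_comm]
    ring
  have h1' : ∀ (v y : EuclideanSpace ℝ (Fin n)),
      fderiv ℝ (fun y : EuclideanSpace ℝ (Fin n) => Real.exp (inner ℝ y ξ)) y v
        = Real.exp (inner ℝ y ξ) * inner ℝ v ξ := by
    intro v y
    simpa using h1 1 v y
  simp only [coordLaplacian, h1', h1]
  have h4 : ∑ i, (ξ i) ^ 2 = 1 := by
    rw [← EuclideanSpace.real_norm_sq_eq, hξ, one_pow]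
  calc _ = Real.exp (inner ℝ x ξ) * ∑ i, (ξ i) ^ 2 := by
        rw [Finset.mul_sum]
        refine Finset.sum_congr rfl fun i _ => ?_
        rw [EuclideanSpace.inner_single_left]
        simp; ring
    _ = _ := by rw [h4, mul_one]

theorem HasWeakGradient.integral_inner_gradient {n : ℕ}
    {f : Lp ℝ 2 (volume : Measure (EuclideanSpace ℝ (Fin n)))}
    {g : Lp (EuclideanSpace ℝ (Fin n)) 2 (volume : Measure (EuclideanSpace ℝ (Fin n)))}
    (h : HasWeakGradient f g) {η : EuclideanSpace ℝ (Fin n) → ℝ} (hη : ContDiff ℝ ∞ η)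
    (hc : HasCompactSupport η) :
    ∫ x, inner ℝ (g x) (∇ η x) = -∫ x, f x * coordLaplacian η x := by
  have h1 : ∀ x, inner ℝ (g x) (∇ η x)
      = ∑ i, inner ℝ (g x) (EuclideanSpace.single i (1 : ℝ)) *
          fderiv ℝ η x (EuclideanSpace.single i 1) := by
    intro x
    rw [inner_gradient_right (𝕜 := ℝ), conj_trivial]
    conv_lhs => rw [← (EuclideanSpace.basisFun (Fin n) ℝ).sum_repr' (g x)]
    rw [map_sum]
    refine Finset.sum_congr rfl fun i _ => ?_
    rw [map_smul, smul_eq_mul, EuclideanSpace.basisFun_apply, real_inner_comm]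
  have hmem : ∀ {χ : EuclideanSpace ℝ (Fin n) → ℝ}, ContDiff ℝ ∞ χ → HasCompactSupport χ →
      MemLp χ 2 volume := fun h1 h2 => h1.continuous.memLp_of_hasCompactSupport h2
  have hg : ∀ v, MemLp (fun x => inner ℝ (g x) v) 2 volume := fun v =>
    (Lp.memLp g).inner_const v
  simp only [h1]
  rw [integral_finsetSum]
  swap
  · exact fun i _ => (hg _).integrable_mul
      (hmem (contDiff_fderiv_apply hη _) (hasCompactSupport_fderiv_coord hc _))
  simp only [coordLaplacian, Finset.mul_sum]
  rw [integral_finsetSum, ← Finset.sum_neg_distrib]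
  · refine Finset.sum_congr rfl fun i _ => ?_
    rw [h _ (contDiff_fderiv_apply hη _) (hasCompactSupport_fderiv_coord hc _), neg_neg]
  · intro i _
    refine (Lp.memLp f).integrable_mul (hmem (contDiff_fderiv_apply (contDiff_fderiv_apply hη _) _)
      (hasCompactSupport_fderiv_coord (hasCompactSupport_fderiv_coord hc _) _))

theorem integral_mul_eq_inner_toLp {α : Type*} [MeasurableSpace α] {μ : Measure α} {η : α → ℝ}
    (hη : MemLp η 2 μ) (f : Lp ℝ 2 μ) : ∫ x, f x * η x ∂μ = inner ℝ (hη.toLp η) f := by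
  rw [L2.inner_def]
  refine integral_congr_ae ?_
  filter_upwards [hη.coeFn_toLp] with x hx
  rw [hx]
  simp

theorem ContinuousOn.integral_mul_L2 {α : Type*} [MeasurableSpace α] {μ : Measure α} {η : α → ℝ}
    (hη : MemLp η 2 μ) {u : ℝ → Lp ℝ 2 μ} {S : Set ℝ} (hu : ContinuousOn u S) :
    ContinuousOn (fun s => ∫ x, u s x * η x ∂μ) S := by
  simp only [integral_mul_eq_inner_toLp hη]
  exact continuousOn_const.inner hu

theorem HasDerivWithinAt.integral_mul_L2 {α : Type*} [MeasurableSpace α] {μ : Measure α}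
    {η : α → ℝ} (hη : MemLp η 2 μ) {u : ℝ → Lp ℝ 2 μ} {w : Lp ℝ 2 μ} {S : Set ℝ} {t : ℝ}
    (hu : HasDerivWithinAt u w S t) :
    HasDerivWithinAt (fun s => ∫ x, u s x * η x ∂μ) (∫ x, w x * η x ∂μ) S t := by
  simp only [integral_mul_eq_inner_toLp hη]
  exact (innerSL ℝ (hη.toLp η)).hasFDerivAt.comp_hasDerivWithinAt t hu

theorem Icc_subset_timeInterval {T : ℝ≥0∞} {t₀ : ℝ} (ht₀ : t₀ ∈ timeInterval T) :
    Icc 0 t₀ ⊆ timeInterval T := fun _ ht =>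
  ⟨ht.1, (ENNReal.ofReal_le_ofReal ht.2).trans_lt ht₀.2⟩

/-- Lower semicontinuity on `L²`, by Fatou's lemma along an almost everywhere convergent subsequence.
No integrability of `|f| ^ p` is assumed; for continuous `u` into `L²` it makes
`s ↦ ∫ |u s| ^ p η` measurable. -/
theorem lowerSemicontinuous_lintegral_rpow_mul {n : ℕ} {p : ℝ} (hp : 0 < p)
    {η : EuclideanSpace ℝ (Fin n) → ℝ} (hη : Continuous η) :
    LowerSemicontinuous (fun f : Lp ℝ 2 (volume : Measure (EuclideanSpace ℝ (Fin n))) =>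
      ∫⁻ x, ENNReal.ofReal (|f x| ^ p * η x)) := by
  rw [lowerSemicontinuous_iff_isClosed_preimage]
  intro c
  refine IsSeqClosed.isClosed fun f g hf hfg => ?_
  obtain ⟨k, -, hk⟩ := (tendstoInMeasure_of_tendsto_Lp hfg).exists_seq_tendsto_ae
  have hlim : ∀ᵐ x, Filter.Tendsto (fun i => ENNReal.ofReal (|f (k i) x| ^ p * η x)) Filter.atTop
      (nhds (ENNReal.ofReal (|g x| ^ p * η x))) := by
    filter_upwards [hk] with x hx
    exact ENNReal.tendsto_ofReal ((hx.abs.rpow_const (Or.inr hp.le)).mul_const _)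
  calc ∫⁻ x, ENNReal.ofReal (|g x| ^ p * η x)
      = ∫⁻ x, Filter.liminf (fun i => ENNReal.ofReal (|f (k i) x| ^ p * η x)) Filter.atTop :=
        lintegral_congr_ae (hlim.mono fun x hx => hx.liminf_eq.symm)
    _ ≤ Filter.liminf (fun i => ∫⁻ x, ENNReal.ofReal (|f (k i) x| ^ p * η x)) Filter.atTop := by
        refine lintegral_liminf_le' fun i => ?_
        have := (Lp.aestronglyMeasurable (f (k i))).aemeasurable
        exact ((this.abs.pow_const p).mul hη.measurable.aemeasurable).ennreal_ofReal
    _ ≤ c := by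
        refine Filter.liminf_le_of_frequently_le' ?_
        exact Filter.Frequently.of_forall fun i => hf (k i)

namespace IsEnergySolutionWith

variable {n : ℕ} {m p ε : ℝ} {u₀ u₁ : EuclideanSpace ℝ (Fin n) → ℝ} {T : ℝ≥0∞}
  {u w : ℝ → Lp ℝ 2 (volume : Measure (EuclideanSpace ℝ (Fin n)))}
  {g : ℝ → Lp (EuclideanSpace ℝ (Fin n)) 2 (volume : Measure (EuclideanSpace ℝ (Fin n)))}

theorem continuousOn_Icc (h : IsEnergySolutionWith m p ε u₀ u₁ T u w g) {t₀ : ℝ}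
    (ht₀ : t₀ ∈ timeInterval T) : ContinuousOn u (Icc 0 t₀) := fun t ht =>
  ((h.deriv t (Icc_subset_timeInterval ht₀ ht)).continuousWithinAt).mono
    (Icc_subset_timeInterval ht₀)

/-- The weak equation for a test function `η` of the space variable, with the Laplacian moved to `η`. -/
theorem weak_eq_space (h : IsEnergySolutionWith m p ε u₀ u₁ T u w g) {t₀ : ℝ}
    (ht₀ : t₀ ∈ timeInterval T) {η : EuclideanSpace ℝ (Fin n) → ℝ} (hη : ContDiff ℝ ∞ η)
    (hc : HasCompactSupport η) {t : ℝ} (ht : t ∈ Icc 0 t₀) :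
    (∫ x, w t x * η x) - ∫ x, w 0 x * η x
      = (∫ s in (0 : ℝ)..t, s ^ m * ∫ x, u s x * coordLaplacian η x)
        + ∫ s in (0 : ℝ)..t, ∫ x, |u s x| ^ p * η x := by
  obtain ⟨t₁, ht₁0, ht₁, ht₁T⟩ : ∃ t₁ : ℝ, 0 ≤ t₁ ∧ t₀ < t₁ ∧ ENNReal.ofReal t₁ < T := by
    obtain ⟨c, hc0, h1, h2⟩ := ENNReal.lt_iff_exists_real_btwn.1 ht₀.2
    exact ⟨c, hc0, ((ENNReal.ofReal_lt_ofReal_iff_of_nonneg ht₀.1).1 h1), h2⟩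
  have h0 : 0 ≤ t₀ := ht₀.1
  -- The cutoff equals `1` near `[0, t₀]` and lives in `[-t₁, t₁]`.
  let χ : ContDiffBump (0 : ℝ) := ⟨(t₀ + t₁) / 2, t₁, by linarith, by linarith⟩
  have hχ1 : ∀ s ∈ Icc 0 t₀, χ s = 1 := fun s hs => χ.one_of_mem_closedBall (by
    rw [mem_closedBall_zero_iff, Real.norm_eq_abs, abs_of_nonneg hs.1]
    change s ≤ (t₀ + t₁) / 2
    linarith [hs.2])
  have hχd : ∀ s ∈ Icc 0 t₀, ∀ c : ℝ, _root_.deriv (fun r => χ r * c) s = 0 := by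
    intro s hs c
    have h1 : (fun r => χ r * c) =ᶠ[nhds s] fun _ => 1 * c := by
      have h2 : (χ : ℝ → ℝ) =ᶠ[nhds s] 1 := χ.eventuallyEq_one_of_mem_ball (by
        rw [mem_ball_zero_iff, Real.norm_eq_abs, abs_of_nonneg hs.1]
        change s < (t₀ + t₁) / 2
        linarith [hs.2])
      filter_upwards [h2] with r hr
      rw [hr]; simp
    rw [h1.deriv_eq]; simp
  have hsupp : tsupport (fun z : ℝ × EuclideanSpace ℝ (Fin n) => χ z.1 * η z.2)
      ⊆ tsupport χ ×ˢ tsupport η := by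
    refine closure_minimal (fun z hz => ?_) ((isClosed_tsupport _).prod (isClosed_tsupport _))
    exact ⟨subset_tsupport _ (left_ne_zero_of_mul hz), subset_tsupport _ (right_ne_zero_of_mul hz)⟩
  have hζ : IsTestFunction T (fun s x => χ s * η x) := by
    refine ⟨?_, ?_, ?_⟩
    · exact (χ.contDiff.comp contDiff_fst).mul (hη.comp contDiff_snd)
    · exact (χ.hasCompactSupport.isCompact.prod hc.isCompact).of_isClosed_subset
        (isClosed_tsupport _) hsupp
    · intro z hz
      have h1 := (hsupp hz).1
      rw [χ.tsupport_eq, mem_closedBall_zero_iff, Real.norm_eq_abs] at h1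
      exact (ENNReal.ofReal_le_ofReal ((le_abs_self _).trans h1)).trans_lt ht₁T
  have hmain := h.weak_eq _ hζ t (Icc_subset_timeInterval ht₀ ht)
  have hsub : uIcc 0 t ⊆ Icc 0 t₀ := by
    rw [uIcc_of_le ht.1]; exact Icc_subset_Icc_right ht.2
  have h2 : ∫ s in (0 : ℝ)..t, ∫ x, |u s x| ^ p * (χ s * η x)
      = ∫ s in (0 : ℝ)..t, ∫ x, |u s x| ^ p * η x := by
    refine intervalIntegral.integral_congr fun s hs => ?_
    simp only [hχ1 s (hsub hs), one_mul]
  have h3 : ∫ s in (0 : ℝ)..t, ∫ x,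
        (w s x * _root_.deriv (fun r => χ r * η x) s
          - s ^ m * inner ℝ (g s x) (∇ (fun y => χ s * η y) x))
      = ∫ s in (0 : ℝ)..t, s ^ m * ∫ x, u s x * coordLaplacian η x := by
    refine intervalIntegral.integral_congr fun s hs => ?_
    simp only [hχ1 s (hsub hs), hχd s (hsub hs), one_mul, mul_zero, zero_sub]
    rw [integral_neg, integral_const_mul, (h.weak_grad s
      (Icc_subset_timeInterval ht₀ (hsub hs))).integral_inner_gradient hη hc]
    ring
  rw [h2, h3, hχ1 t ht, hχ1 0 ⟨le_rfl, h0⟩] at hmain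
  simp only [one_mul] at hmain
  linarith

theorem integrable_rpow_mul (h : IsEnergySolutionWith m p ε u₀ u₁ T u w g) {t : ℝ}
    (ht : t ∈ timeInterval T) {η : EuclideanSpace ℝ (Fin n) → ℝ} (hη : Continuous η)
    (hc : HasCompactSupport η) : Integrable (fun x => |u t x| ^ p * η x) := by
  have h1 := (h.loc _ hc.isCompact t ht).mul_continuousOn hη.continuousOn hc.isCompact
  rw [← integrableOn_iff_integrable_of_support_subset (s := tsupport η)]
  · exact h1
  · intro x hx
    exact subset_tsupport _ (right_ne_zero_of_mul hx)

/-- The local integrability of `|u| ^ p` in time, which concerns sharp cutoffs, extends to smooth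
weights. -/
theorem intervalIntegrable_rpow_mul (h : IsEnergySolutionWith m p ε u₀ u₁ T u w g) (hp : 0 < p)
    {t₀ : ℝ} (ht₀ : t₀ ∈ timeInterval T) {η : EuclideanSpace ℝ (Fin n) → ℝ} (hη : Continuous η)
    (hη0 : ∀ x, 0 ≤ η x) (hc : HasCompactSupport η) :
    IntervalIntegrable (fun s => ∫ x, |u s x| ^ p * η x) volume 0 t₀ := by
  obtain ⟨M, hM⟩ := hη.bounded_above_of_compact_support hc
  have hint := h.loc_time _ hc.isCompact t₀ ht₀
  rw [intervalIntegrable_iff_integrableOn_Icc_of_le ht₀.1] at hint ⊢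
  have heq : ∀ s ∈ Icc 0 t₀, ∫ x, |u s x| ^ p * η x
      = (∫⁻ x, ENNReal.ofReal (|u s x| ^ p * η x)).toReal := by
    intro s hs
    refine integral_eq_lintegral_of_nonneg_ae (Filter.Eventually.of_forall fun x =>
      mul_nonneg (Real.rpow_nonneg (abs_nonneg _) _) (hη0 x)) ?_
    exact (h.integrable_rpow_mul (Icc_subset_timeInterval ht₀ hs) hη hc).aestronglyMeasurable
  have hmeas : AEStronglyMeasurable (fun s => ∫ x, |u s x| ^ p * η x)
      (volume.restrict (Icc 0 t₀)) := by
    have h1 : Measurable (fun s : Icc 0 t₀ => ∫⁻ x, ENNReal.ofReal (|u s x| ^ p * η x)) :=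
      ((lowerSemicontinuous_lintegral_rpow_mul hp hη).comp
        (continuousOn_iff_continuous_domRestrict.1 (h.continuousOn_Icc ht₀))).measurable
    have h2 : AEMeasurable (fun s => ∫⁻ x, ENNReal.ofReal (|u s x| ^ p * η x))
        (volume.restrict (Icc 0 t₀)) :=
      aemeasurable_restrict_of_measurable_subtype measurableSet_Icc h1
    refine h2.ennreal_toReal.aestronglyMeasurable.congr ?_
    filter_upwards [ae_restrict_mem measurableSet_Icc] with s hs
    exact (heq s hs).symm
  refine (hint.const_mul M).mono' hmeas ?_
  filter_upwards [ae_restrict_mem measurableSet_Icc] with s hs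
  have hs' := Icc_subset_timeInterval ht₀ hs
  rw [Real.norm_of_nonneg (integral_nonneg fun x =>
    mul_nonneg (Real.rpow_nonneg (abs_nonneg _) _) (hη0 x)), ← integral_const_mul]
  rw [← setIntegral_eq_integral_of_forall_compl_eq_zero (s := tsupport η) (fun x hx => by
    rw [image_eq_zero_of_notMem_tsupport hx, mul_zero])]
  refine setIntegral_mono (h.integrable_rpow_mul hs' hη hc).integrableOn
    ((h.loc _ hc.isCompact s hs').const_mul M) fun x => ?_
  have h1 : η x ≤ M := (le_abs_self _).trans (hM x)
  rw [mul_comm M]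
  exact mul_le_mul_of_nonneg_left h1 (Real.rpow_nonneg (abs_nonneg _) _)

/-- If `Δη = c η` on a ball that contains the supports of `u(s)` for `s ≤ t₀`, then
`y(t) = ∫ u(t) η` satisfies `y'' = c t ^ m y + ∫ |u| ^ p η` on `[0, t₀]`, in integrated form. -/
theorem integral_eq_of_eigenfunction (h : IsEnergySolutionWith m p ε u₀ u₁ T u w g) (hm : 0 < m)
    (hp : 0 < p) {t₀ ρ c : ℝ} (ht₀ : t₀ ∈ timeInterval T)
    (hsupp : ∀ s ∈ Icc 0 t₀, ∀ᵐ x, ρ < ‖x‖ → u s x = 0)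
    {η : EuclideanSpace ℝ (Fin n) → ℝ} (hη : ContDiff ℝ ∞ η)
    (hη0 : ∀ x, 0 ≤ η x) (hc : HasCompactSupport η)
    (hlap : ∀ x, ‖x‖ ≤ ρ → coordLaplacian η x = c * η x) {s t : ℝ} (hs : 0 ≤ s) (hst : s ≤ t)
    (ht : t ≤ t₀) :
    (∫ x, w t x * η x) - ∫ x, w s x * η x
      = (∫ r in s..t, r ^ m * (c * ∫ x, u r x * η x))
        + ∫ r in s..t, ∫ x, |u r x| ^ p * η x := by
  have hL : ∀ r ∈ Icc 0 t₀, ∫ x, u r x * coordLaplacian η x = c * ∫ x, u r x * η x := by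
    intro r hr
    rw [← integral_const_mul]
    refine integral_congr_ae ?_
    filter_upwards [hsupp r hr] with x hx
    rcases le_or_gt ‖x‖ ρ with h1 | h1
    · rw [hlap x h1]; ring
    · rw [hx h1]; ring
  have hmem : MemLp η 2 volume := hη.continuous.memLp_of_hasCompactSupport hc
  have hcont : ContinuousOn (fun r => r ^ m * (c * ∫ x, u r x * η x)) (Icc 0 t₀) :=
    (Real.continuous_rpow_const hm.le).continuousOn.mul
      (continuousOn_const.mul ((h.continuousOn_Icc ht₀).integral_mul_L2 hmem))
  have hN := h.intervalIntegrable_rpow_mul hp ht₀ hη.continuous hη0 hc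
  have heq : ∀ r ∈ Icc 0 t₀, (∫ x, w r x * η x) - ∫ x, w 0 x * η x
      = (∫ r in (0 : ℝ)..r, r ^ m * (c * ∫ x, u r x * η x))
        + ∫ r in (0 : ℝ)..r, ∫ x, |u r x| ^ p * η x := by
    intro r hr
    rw [h.weak_eq_space ht₀ hη hc hr]
    congr 1
    refine intervalIntegral.integral_congr fun x hx => ?_
    rw [uIcc_of_le hr.1] at hx
    simp only [hL x ⟨hx.1, hx.2.trans hr.2⟩]
  have hsub : ∀ {a b : ℝ}, 0 ≤ a → a ≤ b → b ≤ t₀ → uIcc a b ⊆ Icc 0 t₀ := by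
    intro a b ha hab hb
    rw [uIcc_of_le hab]; exact Icc_subset_Icc ha hb
  have hi1 : ∀ {a b : ℝ}, 0 ≤ a → a ≤ b → b ≤ t₀ →
      IntervalIntegrable (fun r => r ^ m * (c * ∫ x, u r x * η x)) volume a b :=
    fun ha hab hb => (hcont.mono (hsub ha hab hb)).intervalIntegrable
  have hi2 : ∀ {a b : ℝ}, 0 ≤ a → a ≤ b → b ≤ t₀ →
      IntervalIntegrable (fun r => ∫ x, |u r x| ^ p * η x) volume a b := by
    intro a b ha hab hb
    refine hN.mono_set ?_
    rw [uIcc_of_le ht₀.1]; exact hsub ha hab hb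
  have h1 := heq t ⟨hs.trans hst, ht⟩
  have h2 := heq s ⟨hs, hst.trans ht⟩
  have h3 := intervalIntegral.integral_add_adjacent_intervals (hi1 le_rfl hs (hst.trans ht))
    (hi1 hs hst ht)
  have h4 := intervalIntegral.integral_add_adjacent_intervals (hi2 le_rfl hs (hst.trans ht))
    (hi2 hs hst ht)
  linarith

end IsEnergySolutionWith

/-! ### Lower bounds for the source term -/

/-- Hölder's inequality in the form that bounds `∫ |f| ^ p` from below. -/
theorem rpow_le_integral_rpow_mul {α : Type*} [MeasurableSpace α] {μ : Measure α} {p q : ℝ}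
    (hpq : p.HolderConjugate q) {f : α → ℝ} {Ψ : α → ℝ≥0∞} (hf : AEMeasurable f μ)
    (hfp : Integrable (fun x => |f x| ^ p) μ) (hΨ : AEMeasurable Ψ μ) {X Y : ℝ} (hX : 0 ≤ X)
    (hY : 0 ≤ Y) (h1 : ENNReal.ofReal X ≤ ∫⁻ x, ENNReal.ofReal |f x| * Ψ x ∂μ)
    (h2 : ∫⁻ x, Ψ x ^ q ∂μ ≤ ENNReal.ofReal Y) :
    X ^ p ≤ (∫ x, |f x| ^ p ∂μ) * Y ^ (p - 1) := by
  have hp := hpq.pos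
  have hq := hpq.symm.pos
  set I := ∫ x, |f x| ^ p ∂μ with hI
  have hI0 : 0 ≤ I := integral_nonneg fun x => Real.rpow_nonneg (abs_nonneg _) _
  have h3 : ∫⁻ x, ENNReal.ofReal |f x| ^ p ∂μ = ENNReal.ofReal I := by
    rw [hI, ofReal_integral_eq_lintegral_ofReal hfp
      (Filter.Eventually.of_forall fun x => Real.rpow_nonneg (abs_nonneg _) _)]
    exact lintegral_congr fun x => ENNReal.ofReal_rpow_of_nonneg (abs_nonneg _) hp.le
  have h4 := ENNReal.lintegral_mul_le_Lp_mul_Lq μ hpq hf.abs.ennreal_ofReal hΨ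
  simp only [Pi.mul_apply] at h4
  rw [h3] at h4
  have h5 : ENNReal.ofReal X ≤ ENNReal.ofReal (I ^ (1 / p) * Y ^ (1 / q)) := by
    rw [ENNReal.ofReal_mul (Real.rpow_nonneg hI0 _),
      ← ENNReal.ofReal_rpow_of_nonneg hI0 (by positivity),
      ← ENNReal.ofReal_rpow_of_nonneg hY (by positivity)]
    refine (h1.trans h4).trans ?_
    gcongr
  have h6 : X ≤ I ^ (1 / p) * Y ^ (1 / q) :=
    (ENNReal.ofReal_le_ofReal_iff (by positivity)).1 h5
  have h7 : 1 / q * p = p - 1 := by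
    rw [one_div, ← hpq.one_sub_inv]; field_simp
  calc X ^ p ≤ (I ^ (1 / p) * Y ^ (1 / q)) ^ p := Real.rpow_le_rpow hX h6 hp.le
    _ = I * Y ^ (p - 1) := by
        rw [Real.mul_rpow (by positivity) (by positivity), ← Real.rpow_mul hI0,
          ← Real.rpow_mul hY, h7, one_div_mul_cancel hp.ne', Real.rpow_one]

theorem tricomiPhi_nonneg {m t : ℝ} (hm : 0 < m) (ht : 0 ≤ t) : 0 ≤ tricomiPhi m t :=
  mul_nonneg (by positivity) (Real.rpow_nonneg ht _)

theorem tricomiPhi_mono {m s t : ℝ} (hm : 0 < m) (hs : 0 ≤ s) (hst : s ≤ t) :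
    tricomiPhi m s ≤ tricomiPhi m t :=
  mul_le_mul_of_nonneg_left (Real.rpow_le_rpow hs hst (by linarith)) (by positivity)

/-- The radius of the cone is comparable to `t ^ ((m + 2) / 2)`. -/
theorem one_add_cone_bounds {m R t : ℝ} (hm : 0 < m) (hR : 0 ≤ R) (ht : 1 ≤ t) :
    2 / (m + 2) * t ^ ((m + 2) / 2) ≤ 1 + (R + tricomiPhi m t) ∧
      1 + (R + tricomiPhi m t) ≤ (1 + R + 2 / (m + 2)) * t ^ ((m + 2) / 2) := by
  have h1 : 1 ≤ t ^ ((m + 2) / 2) := Real.one_le_rpow ht (by linarith)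
  rw [tricomiPhi]
  constructor
  · linarith
  · nlinarith

theorem exists_le_one_add_cone_rpow {m R : ℝ} (hm : 0 < m) (hR : 0 ≤ R) (b : ℝ) :
    ∃ c : ℝ, 0 < c ∧ ∀ t : ℝ, 1 ≤ t →
      c * t ^ ((m + 2) / 2 * b) ≤ (1 + (R + tricomiPhi m t)) ^ b := by
  rcases le_total 0 b with h | h
  · refine ⟨(2 / (m + 2)) ^ b, by positivity, fun t ht => ?_⟩
    have ht0 : 0 ≤ t := by linarith
    rw [Real.rpow_mul ht0, ← Real.mul_rpow (by positivity) (by positivity)]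
    exact Real.rpow_le_rpow (by positivity) (one_add_cone_bounds hm hR ht).1 h
  · refine ⟨(1 + R + 2 / (m + 2)) ^ b, by positivity, fun t ht => ?_⟩
    have ht0 : 0 ≤ t := by linarith
    rw [Real.rpow_mul ht0, ← Real.mul_rpow (by positivity) (by positivity)]
    exact Real.rpow_le_rpow_of_nonpos (by have := tricomiPhi_nonneg hm ht0; positivity)
      (one_add_cone_bounds hm hR ht).2 h

theorem integral_initial_ge {n : ℕ} {R ρ b : ℝ} {v₀ η : EuclideanSpace ℝ (Fin n) → ℝ}
    (hv : Continuous v₀) (hv0 : ∀ x, 0 ≤ v₀ x) (hsupp : tsupport v₀ ⊆ Metric.closedBall 0 R)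
    (hρ : R ≤ ρ) (hη : Continuous η) (hb : ∀ x, ‖x‖ ≤ ρ → b ≤ η x ) :
    b * ∫ x, v₀ x ≤ ∫ x, v₀ x * η x := by
  have hc : HasCompactSupport v₀ :=
    (isCompact_closedBall 0 R).of_isClosed_subset (isClosed_tsupport _) hsupp
  rw [← integral_const_mul]
  refine integral_mono ((hv.integrable_of_hasCompactSupport hc).const_mul b)
    ((hv.mul hη).integrable_of_hasCompactSupport hc.mul_right) fun x => ?_
  by_cases hx : x ∈ tsupport v₀
  · have h1 : ‖x‖ ≤ ρ := (mem_closedBall_zero_iff.1 (hsupp hx)).trans hρ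
    simp only
    rw [mul_comm]
    exact mul_le_mul_of_nonneg_left (hb x h1) (hv0 x)
  · simp [image_eq_zero_of_notMem_tsupport hx]

theorem initial_mass_pos {n : ℕ} {R : ℝ} {v₀ : EuclideanSpace ℝ (Fin n) → ℝ}
    (hv : Continuous v₀) (hv0 : ∀ x, 0 ≤ v₀ x) (hsupp : tsupport v₀ ⊆ Metric.closedBall 0 R)
    (hne : v₀ ≠ 0) : 0 < ∫ x, v₀ x := by
  obtain ⟨x, hx⟩ := Function.ne_iff.1 hne
  exact hv.integral_pos_of_hasCompactSupport_nonneg_nonzero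
    ((isCompact_closedBall 0 R).of_isClosed_subset (isClosed_tsupport _) hsupp) hv0 hx

theorem SupportedInCone.ae_eq_zero {n : ℕ} {m R : ℝ} {T : ℝ≥0∞}
    {u : ℝ → Lp ℝ 2 (volume : Measure (EuclideanSpace ℝ (Fin n)))} (hcone : SupportedInCone m R T u)
    (hm : 0 < m) {t₀ : ℝ} (ht₀ : t₀ ∈ timeInterval T) :
    ∀ s ∈ Icc 0 t₀, ∀ᵐ x, R + tricomiPhi m t₀ < ‖x‖ → u s x = 0 := by
  intro s hs
  filter_upwards [hcone s (Icc_subset_timeInterval ht₀ hs)] with x hx hxt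
  exact hx (lt_of_le_of_lt (by linarith [tricomiPhi_mono hm hs.1 hs.2]) hxt)

/-- The functionals `∫ u(t) exp ⟪x, ξ⟫`, uniformly in the direction `ξ`, grow at least like the
growing solution of `H'' = t ^ m H`. -/
theorem exists_lintegral_exp_lower {n : ℕ} {m p R : ℝ} (hm : 0 < m) (hp : 0 < p)
    {u₀ u₁ : EuclideanSpace ℝ (Fin n) → ℝ} (hu₀ : Continuous u₀) (hu₁ : Continuous u₁)
    (hu₀_nonneg : ∀ x, 0 ≤ u₀ x) (hu₁_nonneg : ∀ x, 0 ≤ u₁ x)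
    (hu₀_supp : tsupport u₀ ⊆ Metric.closedBall 0 R)
    (hu₁_supp : tsupport u₁ ⊆ Metric.closedBall 0 R)
    (hne : u₀ ≠ 0 ∨ u₁ ≠ 0) :
    ∃ t₁ c : ℝ, 2 ≤ t₁ ∧ 0 < c ∧ ∀ (ε : ℝ) (T : ℝ≥0∞)
      (u w : ℝ → Lp ℝ 2 (volume : Measure (EuclideanSpace ℝ (Fin n))))
      (g : ℝ → Lp (EuclideanSpace ℝ (Fin n)) 2 (volume : Measure (EuclideanSpace ℝ (Fin n)))),
      0 < ε → IsEnergySolutionWith m p ε u₀ u₁ T u w g → SupportedInCone m R T u →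
      ∀ t ∈ timeInterval T, t₁ ≤ t → ∀ ξ : EuclideanSpace ℝ (Fin n), ‖ξ‖ = 1 →
        ENNReal.ofReal (c * ε * (t ^ (-(m / 4)) * Real.exp (tricomiPhi m t))) ≤
          ∫⁻ x in Metric.closedBall 0 (R + tricomiPhi m t),
            ENNReal.ofReal |u t x| * ENNReal.ofReal (Real.exp (inner ℝ x ξ)) := by
  obtain ⟨t₁, δ, ht₁, hδ, hlow⟩ := exists_lower_bound_of_deriv_ge hm
  set A := ∫ x, u₀ x with hA
  set B := ∫ x, u₁ x with hB
  have hA0 : 0 ≤ A := integral_nonneg hu₀_nonneg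
  have hB0 : 0 ≤ B := integral_nonneg hu₁_nonneg
  have hAB : 0 < A + B := by
    rcases hne with h | h
    · exact add_pos_of_pos_of_nonneg (initial_mass_pos hu₀ hu₀_nonneg hu₀_supp h) hB0
    · exact add_pos_of_nonneg_of_pos hA0 (initial_mass_pos hu₁ hu₁_nonneg hu₁_supp h)
  refine ⟨t₁, δ * (Real.exp (-R) * (A + B)), ht₁, by positivity, ?_⟩
  intro ε T u w g hε hsol hcone t ht htt ξ hξ
  set ρ := R + tricomiPhi m t with hρ
  have hRρ : R ≤ ρ := by linarith [tricomiPhi_nonneg hm ht.1]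
  let κ : ContDiffBump (0 : EuclideanSpace ℝ (Fin n)) :=
    ⟨|ρ| + 1, |ρ| + 2, by positivity, by linarith⟩
  have hκ1 : ∀ x : EuclideanSpace ℝ (Fin n), ‖x‖ ≤ ρ → κ =ᶠ[nhds x] 1 := fun x hx =>
    κ.eventuallyEq_one_of_mem_ball (by
      rw [mem_ball_zero_iff]
      change ‖x‖ < |ρ| + 1
      linarith [le_abs_self ρ])
  set η : EuclideanSpace ℝ (Fin n) → ℝ := fun x => Real.exp (inner ℝ x ξ) * κ x with hη
  have hηe : ∀ x : EuclideanSpace ℝ (Fin n), ‖x‖ ≤ ρ →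
      η =ᶠ[nhds x] fun x => Real.exp (inner ℝ x ξ) := fun x hx => by
    filter_upwards [hκ1 x hx] with y hy
    simp [hη, hy]
  have hηsm : ContDiff ℝ ∞ η := ((contDiff_id.inner ℝ contDiff_const).exp).mul κ.contDiff
  have hη0 : ∀ x, 0 ≤ η x := fun x => mul_nonneg (Real.exp_pos _).le κ.nonneg
  have hηc : HasCompactSupport η := κ.hasCompactSupport.mul_left
  have hmem : MemLp η 2 volume := hηsm.continuous.memLp_of_hasCompactSupport hηc
  have hlap : ∀ x, ‖x‖ ≤ ρ → coordLaplacian η x = 1 * η x := fun x hx => by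
    rw [coordLaplacian_congr (hηe x hx), coordLaplacian_exp_inner hξ, (hηe x hx).self_of_nhds,
      one_mul]
  have hηR : ∀ x, ‖x‖ ≤ R → Real.exp (-R) ≤ η x := by
    intro x hx
    rw [(hηe x (hx.trans hRρ)).self_of_nhds]
    apply Real.exp_le_exp.2
    have h1 := (abs_le.1 (abs_real_inner_le_norm x ξ)).1
    rw [hξ, mul_one] at h1
    linarith
  have hinit : ∀ {f : Lp ℝ 2 (volume : Measure (EuclideanSpace ℝ (Fin n)))}
      {v : EuclideanSpace ℝ (Fin n) → ℝ}, f =ᵐ[volume] (fun x => ε * v x) → Continuous v →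
      (∀ x, 0 ≤ v x) → tsupport v ⊆ Metric.closedBall 0 R →
      ε * (Real.exp (-R) * ∫ x, v x) ≤ ∫ x, f x * η x := by
    intro f v hf hv hv0 hvs
    have h1 : ∫ x, f x * η x = ε * ∫ x, v x * η x := by
      rw [← integral_const_mul]
      refine integral_congr_ae ?_
      filter_upwards [hf] with x hx
      rw [hx, mul_assoc]
    rw [h1]
    exact mul_le_mul_of_nonneg_left
      (integral_initial_ge hv hv0 hvs le_rfl hηsm.continuous hηR) hε.le
  have hmain := hlow t (ε * (Real.exp (-R) * A)) (ε * (Real.exp (-R) * B))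
    (fun s => ∫ x, u s x * η x) (fun s => ∫ x, w s x * η x) (by positivity) (by positivity)
    (fun s hs => ((hsol.deriv s (Icc_subset_timeInterval ht hs)).mono
      (Icc_subset_timeInterval ht)).integral_mul_L2 hmem)
    (fun s r hs hsr hr => by
      have h1 := hsol.integral_eq_of_eigenfunction hm hp ht (hcone.ae_eq_zero hm ht) hηsm hη0 hηc
        hlap hs hsr hr
      have h2 : 0 ≤ ∫ r in s..r, ∫ x, |u r x| ^ p * η x :=
        intervalIntegral.integral_nonneg hsr fun r _ => integral_nonneg fun x =>
          mul_nonneg (Real.rpow_nonneg (abs_nonneg _) _) (hη0 x)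
      simp only [one_mul] at h1
      linarith)
    (hinit hsol.init hu₀ hu₀_nonneg hu₀_supp) (hinit hsol.init_deriv hu₁ hu₁_nonneg hu₁_supp)
    t ⟨htt, le_rfl⟩
  have h3 : δ * (Real.exp (-R) * (A + B)) * ε * (t ^ (-(m / 4)) * Real.exp (tricomiPhi m t))
      ≤ ∫ x, u t x * η x := by
    refine le_trans (le_of_eq ?_) hmain
    ring
  have hint : Integrable (fun x => u t x * η x) := (Lp.memLp (u t)).integrable_mul hmem
  calc ENNReal.ofReal _ ≤ ENNReal.ofReal (∫ x, u t x * η x) := ENNReal.ofReal_le_ofReal h3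
    _ ≤ ENNReal.ofReal (∫ x, |u t x * η x|) :=
        ENNReal.ofReal_le_ofReal (integral_mono hint hint.abs fun x => le_abs_self _)
    _ = ∫⁻ x, ENNReal.ofReal |u t x * η x| :=
        ofReal_integral_eq_lintegral_ofReal hint.abs (Filter.Eventually.of_forall fun x =>
          abs_nonneg _)
    _ ≤ ∫⁻ x, (Metric.closedBall (0 : EuclideanSpace ℝ (Fin n)) ρ).indicator (fun x =>
          ENNReal.ofReal |u t x| * ENNReal.ofReal (Real.exp (inner ℝ x ξ))) x := by
        refine lintegral_mono_ae ?_
        filter_upwards [hcone t ht] with x hx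
        rcases le_or_gt ‖x‖ ρ with h | h
        · rw [indicator_of_mem (mem_closedBall_zero_iff.2 h), abs_mul,
            ENNReal.ofReal_mul (abs_nonneg _), abs_of_nonneg (hη0 x), (hηe x h).self_of_nhds]
        · simp [hx h]
    _ = _ := lintegral_indicator Metric.isClosed_closedBall.measurableSet _

theorem exists_integral_rpow_lower {n : ℕ} (hn : 1 ≤ n) {m p R : ℝ} (hm : 0 < m) (hp : 1 < p)
    (hR : 0 ≤ R)
    {u₀ u₁ : EuclideanSpace ℝ (Fin n) → ℝ} (hu₀ : Continuous u₀) (hu₁ : Continuous u₁)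
    (hu₀_nonneg : ∀ x, 0 ≤ u₀ x) (hu₁_nonneg : ∀ x, 0 ≤ u₁ x)
    (hu₀_supp : tsupport u₀ ⊆ Metric.closedBall 0 R)
    (hu₁_supp : tsupport u₁ ⊆ Metric.closedBall 0 R)
    (hne : u₀ ≠ 0 ∨ u₁ ≠ 0) :
    ∃ t₁ c : ℝ, 2 ≤ t₁ ∧ 0 < c ∧ ∀ (ε : ℝ) (T : ℝ≥0∞)
      (u w : ℝ → Lp ℝ 2 (volume : Measure (EuclideanSpace ℝ (Fin n))))
      (g : ℝ → Lp (EuclideanSpace ℝ (Fin n)) 2 (volume : Measure (EuclideanSpace ℝ (Fin n)))),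
      0 < ε → IsEnergySolutionWith m p ε u₀ u₁ T u w g → SupportedInCone m R T u →
      ∀ t ∈ timeInterval T, t₁ ≤ t →
        c * ε ^ p * t ^ (-(m * p / 4 + (m + 2) * (n - 1) * (p - 2) / 4)) ≤
          ∫ x in Metric.closedBall 0 (R + tricomiPhi m t), |u t x| ^ p := by
  obtain ⟨t₁, c₀, ht₁, hc₀, hlow⟩ := exists_lintegral_exp_lower hm (by linarith : 0 < p) hu₀ hu₁
    hu₀_nonneg hu₁_nonneg hu₀_supp hu₁_supp hne
  have hpq : p.HolderConjugate (p / (p - 1)) := Real.HolderConjugate.conjExponent hp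
  set q := p / (p - 1) with hq
  have hp1 : 0 < p - 1 := by linarith
  have hq0 : 0 < q := by positivity
  have hqp : q * (p - 1) = p := by rw [hq]; field_simp
  obtain ⟨C₁, hC₁, hΦ⟩ := exists_lintegral_exp_inner_le n hn
  obtain ⟨C₂, hC₂, hball⟩ := exists_lintegral_closedBall_rpow_le n hn hq0
  set β := ((n : ℝ) - 1) * (1 - q / 2) with hβ
  obtain ⟨c₁, hc₁, hcone_rpow⟩ := exists_le_one_add_cone_rpow hm hR (-(β * (p - 1)))
  set V : ℝ := volume.real (Metric.closedBall (0 : EuclideanSpace ℝ (Fin n)) 1) with hV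
  have hV0 : 0 < V := ENNReal.toReal_pos (Metric.measure_closedBall_pos _ _ one_pos).ne'
    measure_closedBall_lt_top.ne
  set K := (V * c₀ * Real.exp (-R)) ^ p / (C₁ ^ q * C₂) ^ (p - 1) with hK
  refine ⟨t₁, K * c₁, ht₁, by positivity, ?_⟩
  intro ε T u w g hε hsol hcone t ht htt
  have ht0 : 0 < t := by linarith
  set ρ := R + tricomiPhi m t with hρ
  have hρ0 : 0 ≤ ρ := add_nonneg hR (tricomiPhi_nonneg hm ht0.le)
  have hρ1 : 0 < 1 + ρ := by linarith
  have humeas : AEMeasurable (u t) (volume.restrict (Metric.closedBall 0 ρ)) :=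
    (Lp.aestronglyMeasurable (u t)).aemeasurable.restrict
  set X := V * (c₀ * ε * (t ^ (-(m / 4)) * Real.exp (tricomiPhi m t))) with hX
  set Y := C₁ ^ q * (C₂ * (Real.exp (q * ρ) * (1 + ρ) ^ β)) with hY
  -- Average the lower bound over directions, exchange the integrals and bound the average.
  have h1 : ENNReal.ofReal X ≤ ∫⁻ x in Metric.closedBall 0 ρ, ENNReal.ofReal |u t x| *
      (ENNReal.ofReal C₁ *
        ENNReal.ofReal (Real.exp ‖x‖ * (1 + ‖x‖) ^ (-(((n : ℝ) - 1) / 2)))) := by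
    have hn0 : NeZero n := ⟨by omega⟩
    have hnt : Nontrivial (EuclideanSpace ℝ (Fin n)) := by
      refine ⟨⟨EuclideanSpace.single 0 1, 0, fun h => ?_⟩⟩
      have := congrArg norm h
      simp at this
    have hdir : ∀ᵐ y ∂(volume.restrict (Metric.closedBall (0 : EuclideanSpace ℝ (Fin n)) 1)),
        ENNReal.ofReal (c₀ * ε * (t ^ (-(m / 4)) * Real.exp (tricomiPhi m t))) ≤
          ∫⁻ x in Metric.closedBall 0 ρ, ENNReal.ofReal |u t x| *
            ENNReal.ofReal (Real.exp (inner ℝ x (‖y‖⁻¹ • y))) := by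
      refine ae_restrict_of_ae ?_
      filter_upwards [compl_mem_ae_iff.2 (measure_singleton (0 : EuclideanSpace ℝ (Fin n)))]
        with y hy
      have hy0 : ‖y‖ ≠ 0 := norm_ne_zero_iff.2 hy
      refine hlow ε T u w g hε hsol hcone t ht htt _ ?_
      rw [norm_smul, norm_inv, norm_norm, inv_mul_cancel₀ hy0]
    have hω : Measurable (fun y : EuclideanSpace ℝ (Fin n) => ‖y‖⁻¹ • y) :=
      (measurable_norm.inv).smul measurable_id
    have hker : Measurable (fun z : EuclideanSpace ℝ (Fin n) × EuclideanSpace ℝ (Fin n) =>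
        ENNReal.ofReal (Real.exp (inner ℝ z.2 (‖z.1‖⁻¹ • z.1)))) :=
      (Real.measurable_exp.comp (measurable_snd.inner (hω.comp measurable_fst))).ennreal_ofReal
    calc ENNReal.ofReal X
        = ∫⁻ _ in Metric.closedBall (0 : EuclideanSpace ℝ (Fin n)) 1,
            ENNReal.ofReal (c₀ * ε * (t ^ (-(m / 4)) * Real.exp (tricomiPhi m t))) := by
          rw [setLIntegral_const, hX, ENNReal.ofReal_mul hV0.le, mul_comm, hV,
            ofReal_measureReal measure_closedBall_lt_top.ne]
      _ ≤ ∫⁻ y in Metric.closedBall (0 : EuclideanSpace ℝ (Fin n)) 1,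
            ∫⁻ x in Metric.closedBall 0 ρ, ENNReal.ofReal |u t x| *
              ENNReal.ofReal (Real.exp (inner ℝ x (‖y‖⁻¹ • y))) := lintegral_mono_ae hdir
      _ = ∫⁻ x in Metric.closedBall 0 ρ,
            ∫⁻ y in Metric.closedBall (0 : EuclideanSpace ℝ (Fin n)) 1, ENNReal.ofReal |u t x| *
              ENNReal.ofReal (Real.exp (inner ℝ x (‖y‖⁻¹ • y))) := by
          refine lintegral_lintegral_swap (AEMeasurable.mul ?_ hker.aemeasurable)
          exact (humeas.abs.ennreal_ofReal).comp_snd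
      _ ≤ _ := by
          refine lintegral_mono fun x => ?_
          rw [lintegral_const_mul' _ _ ENNReal.ofReal_ne_top, ← ENNReal.ofReal_mul hC₁.le]
          gcongr
          exact hΦ x
  have h2 : ∫⁻ x in Metric.closedBall (0 : EuclideanSpace ℝ (Fin n)) ρ, (ENNReal.ofReal C₁ *
        ENNReal.ofReal (Real.exp ‖x‖ * (1 + ‖x‖) ^ (-(((n : ℝ) - 1) / 2)))) ^ q
      ≤ ENNReal.ofReal Y := by
    simp only [ENNReal.mul_rpow_of_nonneg _ _ hq0.le]
    rw [ENNReal.ofReal_rpow_of_nonneg hC₁.le hq0.le, lintegral_const_mul' _ _ ENNReal.ofReal_ne_top,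
      hY, ENNReal.ofReal_mul (by positivity)]
    gcongr
    exact hball ρ hρ0
  have h3 := rpow_le_integral_rpow_mul hpq humeas (hsol.loc _ (isCompact_closedBall 0 ρ) t ht)
    (by fun_prop) (by positivity : 0 ≤ X) (by positivity : 0 ≤ Y) h1 h2
  set I := ∫ x in Metric.closedBall 0 ρ, |u t x| ^ p with hI
  have hY0 : 0 < Y := by positivity
  rw [← div_le_iff₀ (by positivity)] at h3
  refine le_trans ?_ h3
  have hXe : X = V * c₀ * Real.exp (-R) * ε * t ^ (-(m / 4)) * Real.exp ρ := by
    have : Real.exp (tricomiPhi m t) = Real.exp (-R) * Real.exp ρ := by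
      rw [← Real.exp_add]; congr 1; rw [hρ]; ring
    rw [hX, this]; ring
  have hXp : X ^ p = (V * c₀ * Real.exp (-R)) ^ p * ε ^ p * t ^ (-(m / 4) * p) *
      Real.exp (ρ * p) := by
    rw [hXe, Real.mul_rpow (by positivity) (by positivity),
      Real.mul_rpow (by positivity) (by positivity),
      Real.mul_rpow (by positivity) (by positivity), ← Real.rpow_mul ht0.le, ← Real.exp_mul]
  have hYp : Y ^ (p - 1) = (C₁ ^ q * C₂) ^ (p - 1) * Real.exp (ρ * p) *
      (1 + ρ) ^ (β * (p - 1)) := by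
    have : Y = C₁ ^ q * C₂ * Real.exp (q * ρ) * (1 + ρ) ^ β := by rw [hY]; ring
    rw [this, Real.mul_rpow (by positivity) (by positivity),
      Real.mul_rpow (by positivity) (by positivity), ← Real.rpow_mul hρ1.le, ← Real.exp_mul]
    congr 3
    rw [mul_right_comm, hqp, mul_comm]
  have h4 : X ^ p / Y ^ (p - 1)
      = K * ε ^ p * (t ^ (-(m / 4) * p) * (1 + ρ) ^ (-(β * (p - 1)))) := by
    rw [hXp, hYp, hK, Real.rpow_neg hρ1.le]
    have := Real.exp_pos (ρ * p)
    field_simp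
  have h5 : t ^ (-(m * p / 4 + (m + 2) * (n - 1) * (p - 2) / 4))
      = t ^ (-(m / 4) * p) * t ^ ((m + 2) / 2 * -(β * (p - 1))) := by
    rw [← Real.rpow_add ht0]
    congr 1
    have : β * (p - 1) = ((n : ℝ) - 1) * (p - 2) / 2 := by
      rw [hβ, show ((n : ℝ) - 1) * (1 - q / 2) * (p - 1)
        = ((n : ℝ) - 1) * ((p - 1) - q * (p - 1) / 2) by ring, hqp]
      ring
    rw [this]; ring
  rw [h4, h5]
  have h6 := hcone_rpow t (by linarith)
  calc K * c₁ * ε ^ p * (t ^ (-(m / 4) * p) * t ^ ((m + 2) / 2 * -(β * (p - 1))))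
      = K * ε ^ p * (t ^ (-(m / 4) * p) * (c₁ * t ^ ((m + 2) / 2 * -(β * (p - 1))))) := by ring
    _ ≤ K * ε ^ p * (t ^ (-(m / 4) * p) * (1 + ρ) ^ (-(β * (p - 1)))) := by gcongr

/-! ### Blow-up of the spatial integral -/

theorem tricomiGamma_pos {m p pc : ℝ} {n : ℕ} (hn : 1 ≤ n) (hm : 0 < m)
    (hpc : tricomiGamma m n pc = 0) (hp : 0 < p) (hp_sub : p < pc) : 0 < tricomiGamma m n p := by
  have hn' : (1 : ℝ) ≤ n := by exact_mod_cast hn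
  have hpc_pos : 0 < pc := hp.trans hp_sub
  simp only [tricomiGamma] at hpc ⊢
  have hlead : 0 < (m + 2) * ((n : ℝ) / 2) - 1 := by nlinarith
  set a := (m + 2) * ((n : ℝ) / 2) - 1
  set b := (m + 2) * (1 - (n : ℝ) / 2) - 3
  -- A concave quadratic with positive value at `0` is positive before its positive root.
  have h1 : (-a * p ^ 2 - b * p + (m + 2)) * pc
      = (pc - p) * (a * p * pc + (m + 2)) := by
    have h2 : b * pc = -a * pc ^ 2 + (m + 2) := by linarith
    linear_combination -p * h2
  have h3 : 0 < (-a * p ^ 2 - b * p + (m + 2)) * pc := by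
    rw [h1]
    have : 0 < pc - p := by linarith
    positivity
  exact pos_of_mul_pos_left h3 hpc_pos.le

/-- The spatial integral `y = ∫ u` of a solution supported in the cone satisfies
`y'' = N = ∫ |u| ^ p`, here in the form of lower bounds for increments of `E = y'`, and Hölder's
inequality on the cone bounds `|y| ^ p` by `N`. -/
theorem exists_spatial_integral {n : ℕ} {m p R ε : ℝ} (hm : 0 < m) (hp : 1 < p) (hR : 0 ≤ R)
    {u₀ u₁ : EuclideanSpace ℝ (Fin n) → ℝ} {T : ℝ≥0∞}
    {u w : ℝ → Lp ℝ 2 (volume : Measure (EuclideanSpace ℝ (Fin n)))}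
    {g : ℝ → Lp (EuclideanSpace ℝ (Fin n)) 2 (volume : Measure (EuclideanSpace ℝ (Fin n)))}
    (hu₀_nonneg : ∀ x, 0 ≤ u₀ x) (hu₁_nonneg : ∀ x, 0 ≤ u₁ x)
    (hε : 0 < ε) (hsol : IsEnergySolutionWith m p ε u₀ u₁ T u w g)
    (hcone : SupportedInCone m R T u) {t₀ : ℝ} (ht₀ : t₀ ∈ timeInterval T) :
    ∃ y E : ℝ → ℝ, (∀ t ∈ Icc 0 t₀, HasDerivWithinAt y (E t) (Icc 0 t₀) t) ∧ 0 ≤ y 0 ∧ 0 ≤ E 0 ∧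
      (∀ s t c, 0 ≤ s → s ≤ t → t ≤ t₀ →
        (∀ r ∈ Icc s t, c ≤ ∫ x in Metric.closedBall 0 (R + tricomiPhi m r), |u r x| ^ p) →
        c * (t - s) ≤ E t - E s) ∧
      ∀ t ∈ Icc 0 t₀, |y t| ^ p ≤
        (∫ x in Metric.closedBall 0 (R + tricomiPhi m t), |u t x| ^ p) *
          ((1 + (R + tricomiPhi m t)) ^ n *
            volume.real (Metric.closedBall (0 : EuclideanSpace ℝ (Fin n)) 1)) ^ (p - 1) := by
  have hp0 : 0 < p := by linarith
  set ρ := R + tricomiPhi m t₀ with hρ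
  let κ : ContDiffBump (0 : EuclideanSpace ℝ (Fin n)) :=
    ⟨|ρ| + 1, |ρ| + 2, by positivity, by linarith⟩
  have hκ1 : ∀ x : EuclideanSpace ℝ (Fin n), ‖x‖ ≤ ρ → κ =ᶠ[nhds x] fun _ => 1 := fun x hx =>
    κ.eventuallyEq_one_of_mem_ball (by
      rw [mem_ball_zero_iff]
      change ‖x‖ < |ρ| + 1
      linarith [le_abs_self ρ])
  have hκs : ContDiff ℝ ∞ κ := κ.contDiff
  have hκc := κ.hasCompactSupport
  have hmem : MemLp κ 2 volume := hκs.continuous.memLp_of_hasCompactSupport hκc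
  have hκ0 : ∀ x, 0 ≤ κ x := fun x => κ.nonneg
  have hlap : ∀ x, ‖x‖ ≤ ρ → coordLaplacian κ x = 0 * κ x := fun x hx => by
    rw [coordLaplacian_congr (hκ1 x hx), coordLaplacian_one, zero_mul]
  have hmono : ∀ t ∈ Icc 0 t₀, R + tricomiPhi m t ≤ ρ := fun t ht => by
    linarith [tricomiPhi_mono hm ht.1 ht.2]
  have hsource : ∀ t ∈ Icc 0 t₀, ∫ x, |u t x| ^ p * κ x
      = ∫ x in Metric.closedBall 0 (R + tricomiPhi m t), |u t x| ^ p := by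
    intro t ht
    rw [← integral_indicator Metric.isClosed_closedBall.measurableSet]
    refine integral_congr_ae ?_
    filter_upwards [hcone t (Icc_subset_timeInterval ht₀ ht)] with x hx
    rcases le_or_gt ‖x‖ (R + tricomiPhi m t) with h | h
    · rw [indicator_of_mem (mem_closedBall_zero_iff.2 h),
        (hκ1 x (h.trans (hmono t ht))).self_of_nhds, mul_one]
    · rw [indicator_of_notMem (by simpa using h), hx h, abs_zero, Real.zero_rpow hp0.ne', zero_mul]
  have hinit : ∀ {f : Lp ℝ 2 (volume : Measure (EuclideanSpace ℝ (Fin n)))}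
      {v : EuclideanSpace ℝ (Fin n) → ℝ}, f =ᵐ[volume] (fun x => ε * v x) →
      (∀ x, 0 ≤ v x) → 0 ≤ ∫ x, f x * κ x := by
    intro f v hf hv0
    refine integral_nonneg_of_ae ?_
    filter_upwards [hf] with x hx
    rw [hx]
    exact mul_nonneg (mul_nonneg hε.le (hv0 x)) (hκ0 x)
  refine ⟨fun t => ∫ x, u t x * κ x, fun t => ∫ x, w t x * κ x, ?_,
    hinit hsol.init hu₀_nonneg, hinit hsol.init_deriv hu₁_nonneg, ?_, ?_⟩
  · exact fun t ht => ((hsol.deriv t (Icc_subset_timeInterval ht₀ ht)).mono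
      (Icc_subset_timeInterval ht₀)).integral_mul_L2 hmem
  · intro s t c hs hst ht hc
    have h1 := hsol.integral_eq_of_eigenfunction hm hp0 ht₀ (hcone.ae_eq_zero hm ht₀) hκs hκ0 hκc
      hlap hs hst ht
    simp only [zero_mul, mul_zero, intervalIntegral.integral_zero, zero_add] at h1
    simp only [h1]
    have h2 : ∫ _ in s..t, c ≤ ∫ r in s..t, ∫ x, |u r x| ^ p * κ x := by
      refine intervalIntegral.integral_mono_on hst (by simp) ?_ fun r hr => ?_
      · refine (hsol.intervalIntegrable_rpow_mul hp0 ht₀ hκs.continuous hκ0 hκc).mono_set ?_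
        rw [uIcc_of_le hst, uIcc_of_le ht₀.1]
        exact Icc_subset_Icc hs ht
      · rw [hsource r ⟨hs.trans hr.1, hr.2.trans ht⟩]
        exact hc r hr
    rw [intervalIntegral.integral_const, smul_eq_mul, mul_comm] at h2
    exact h2
  · intro t ht
    set r := R + tricomiPhi m t with hr
    have hr0 : 0 ≤ r := add_nonneg hR (tricomiPhi_nonneg hm ht.1)
    have htT := Icc_subset_timeInterval ht₀ ht
    have hint : Integrable (fun x => u t x * κ x) := (Lp.memLp (u t)).integrable_mul hmem
    refine rpow_le_integral_rpow_mul (μ := volume.restrict (Metric.closedBall 0 r))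
      (f := u t) (Ψ := fun _ => 1) (Real.HolderConjugate.conjExponent hp)
      (Lp.aestronglyMeasurable (u t)).aemeasurable.restrict
      (hsol.loc _ (isCompact_closedBall 0 r) t htT) aemeasurable_const (abs_nonneg _)
      (by positivity) ?_ ?_
    · calc ENNReal.ofReal |∫ x, u t x * κ x| ≤ ENNReal.ofReal (∫ x, |u t x * κ x|) :=
            ENNReal.ofReal_le_ofReal abs_integral_le_integral_abs
        _ = ∫⁻ x, ENNReal.ofReal |u t x * κ x| :=
            ofReal_integral_eq_lintegral_ofReal hint.abs (Filter.Eventually.of_forall fun x =>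
              abs_nonneg _)
        _ ≤ ∫⁻ x, (Metric.closedBall (0 : EuclideanSpace ℝ (Fin n)) r).indicator (fun x =>
              ENNReal.ofReal |u t x| * 1) x := by
            refine lintegral_mono_ae ?_
            filter_upwards [hcone t htT] with x hx
            rcases le_or_gt ‖x‖ r with h | h
            · rw [indicator_of_mem (mem_closedBall_zero_iff.2 h),
                (hκ1 x (h.trans (hmono t ht))).self_of_nhds]
              simp
            · simp [hx h]
        _ = _ := lintegral_indicator Metric.isClosed_closedBall.measurableSet _
    · simp only [ENNReal.one_rpow, lintegral_const, one_mul, Measure.restrict_apply_univ]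
      rw [Measure.addHaar_closedBall' volume 0 hr0, finrank_euclideanSpace, Fintype.card_fin,
        ENNReal.ofReal_mul (by positivity), ofReal_measureReal measure_closedBall_lt_top.ne]
      gcongr
      linarith

theorem exists_mul_rpow_le_rpow (a : ℝ) :
    ∃ k : ℝ, 0 < k ∧ ∀ τ r : ℝ, 0 < τ → τ ≤ r → r ≤ 3 * τ → k * τ ^ a ≤ r ^ a := by
  refine ⟨min 1 (3 ^ a), by positivity, fun τ r hτ h1 h2 => ?_⟩
  have hτa : 0 ≤ τ ^ a := by positivity
  rcases le_total 0 a with h | h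
  · calc min 1 (3 ^ a) * τ ^ a ≤ 1 * τ ^ a := by gcongr; exact min_le_left _ _
      _ ≤ r ^ a := by rw [one_mul]; gcongr
  · calc min 1 (3 ^ a) * τ ^ a ≤ 3 ^ a * τ ^ a := by gcongr; exact min_le_right _ _
      _ = (3 * τ) ^ a := (Real.mul_rpow (by norm_num) hτ.le).symm
      _ ≤ r ^ a := Real.rpow_le_rpow_of_nonpos (by linarith) h2 h

/-- A solution on `[0, 3 τ]` with `τ` beyond a fixed time forces
`ε ^ (p (p - 1)) τ ^ (γ / 2)` to stay bounded. The interval `[τ, 2 τ]` is used to make `∫ u` large,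
the interval `[2 τ, 3 τ]` to make it blow up. -/
theorem exists_rpow_mul_rpow_lt {n : ℕ} (hn : 1 ≤ n) {m p R : ℝ} (hm : 0 < m) (hp : 1 < p)
    (hR : 0 ≤ R)
    {u₀ u₁ : EuclideanSpace ℝ (Fin n) → ℝ} (hu₀ : Continuous u₀) (hu₁ : Continuous u₁)
    (hu₀_nonneg : ∀ x, 0 ≤ u₀ x) (hu₁_nonneg : ∀ x, 0 ≤ u₁ x)
    (hu₀_supp : tsupport u₀ ⊆ Metric.closedBall 0 R)
    (hu₁_supp : tsupport u₁ ⊆ Metric.closedBall 0 R)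
    (hne : u₀ ≠ 0 ∨ u₁ ≠ 0) :
    ∃ t₁ K : ℝ, 0 < t₁ ∧ 0 < K ∧ ∀ (ε : ℝ) (T : ℝ≥0∞)
      (u w : ℝ → Lp ℝ 2 (volume : Measure (EuclideanSpace ℝ (Fin n))))
      (g : ℝ → Lp (EuclideanSpace ℝ (Fin n)) 2 (volume : Measure (EuclideanSpace ℝ (Fin n)))),
      0 < ε → IsEnergySolutionWith m p ε u₀ u₁ T u w g → SupportedInCone m R T u →
      ∀ τ : ℝ, t₁ ≤ τ → 3 * τ ∈ timeInterval T →
        ε ^ (p * (p - 1)) * τ ^ (tricomiGamma m n p / 2) < K := by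
  have hp1 : 0 < p - 1 := by linarith
  obtain ⟨t₁, c, ht₁, hc, hlow⟩ := exists_integral_rpow_lower hn hm hp hR hu₀ hu₁
    hu₀_nonneg hu₁_nonneg hu₀_supp hu₁_supp hne
  set α := m * p / 4 + (m + 2) * ((n : ℝ) - 1) * (p - 2) / 4 with hα
  obtain ⟨k, hk, hkr⟩ := exists_mul_rpow_le_rpow (-α)
  set V : ℝ := volume.real (Metric.closedBall (0 : EuclideanSpace ℝ (Fin n)) 1) with hV
  have hV0 : 0 < V := ENNReal.toReal_pos (Metric.measure_closedBall_pos _ _ one_pos).ne'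
    measure_closedBall_lt_top.ne
  set D := (1 + R + 2 / (m + 2)) * 3 ^ ((m + 2) / 2) with hD
  have hD0 : 0 < D := by positivity
  set b := ((D ^ n * V) ^ (p - 1))⁻¹ with hb
  have hb0 : 0 < b := by positivity
  set θ := 1 - (2 : ℝ) ^ (-(p - 1) / 2) with hθ
  have hθ0 : 0 < θ := by
    have : (2 : ℝ) ^ (-(p - 1) / 2) < 1 :=
      Real.rpow_lt_one_of_one_lt_of_neg (by norm_num) (by linarith)
    linarith
  refine ⟨t₁, 2 / θ ^ 2 / (b * (c * k / 2) ^ (p - 1)), by linarith, by positivity, ?_⟩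
  intro ε T u w g hε hsol hcone τ hτt hτT
  have hτ2 : 2 ≤ τ := ht₁.trans hτt
  have hτ : 0 < τ := by linarith
  obtain ⟨y, E, hy, hy0, hE0, hinc, hhol⟩ := exists_spatial_integral hm hp hR hu₀_nonneg hu₁_nonneg
    hε hsol hcone hτT
  set N : ℝ → ℝ := fun r => ∫ x in Metric.closedBall 0 (R + tricomiPhi m r), |u r x| ^ p with hN
  have hN0 : ∀ r, 0 ≤ N r := fun r => integral_nonneg fun x => Real.rpow_nonneg (abs_nonneg _) _
  have hE : ∀ r ∈ Icc 0 (3 * τ), 0 ≤ E r := fun r hr => by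
    have := hinc 0 r 0 le_rfl hr.1 hr.2 fun x _ => hN0 x
    linarith
  have hyτ : 0 ≤ y τ := by
    have hsub : Icc 0 τ ⊆ Icc 0 (3 * τ) := Icc_subset_Icc_right (by linarith)
    have := add_sq_le_of_deriv_ge (c := 0) hτ.le (fun r hr => (hy r (hsub hr)).mono hsub)
      fun r hr => by rw [zero_mul]; exact hE r (hsub hr)
    linarith
  have hNlow : ∀ r ∈ Icc τ (3 * τ), c * k * ε ^ p * τ ^ (-α) ≤ N r := fun r hr => by
    have h1 := hlow ε T u w g hε hsol hcone r
      (Icc_subset_timeInterval hτT ⟨hτ.le.trans hr.1, hr.2⟩) (hτt.trans hr.1)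
    refine le_trans ?_ h1
    have h2 := hkr τ r hτ hr.1 hr.2
    calc c * k * ε ^ p * τ ^ (-α) = c * ε ^ p * (k * τ ^ (-α)) := by ring
      _ ≤ _ := by gcongr
  set Y := c * k / 2 * ε ^ p * τ ^ (2 - α) with hY
  have hY0 : 0 < Y := by positivity
  have hY2 : Y ≤ y (2 * τ) := by
    have hsub : Icc τ (2 * τ) ⊆ Icc 0 (3 * τ) := Icc_subset_Icc hτ.le (by linarith)
    have h1 := add_sq_le_of_deriv_ge (c := c * k * ε ^ p * τ ^ (-α)) (by linarith : τ ≤ 2 * τ)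
      (fun r hr => (hy r (hsub hr)).mono hsub) fun r hr => by
        have h2 := hinc τ r _ hτ.le hr.1 (hsub hr).2 fun x hx =>
          hNlow x ⟨hx.1, hx.2.trans (hsub hr).2⟩
        have h3 := hE τ ⟨hτ.le, by linarith⟩
        linarith
    have h4 : τ ^ (2 - α) = τ ^ 2 * τ ^ (-α) := by
      rw [sub_eq_add_neg, Real.rpow_add hτ]
      norm_cast
    rw [hY, h4]
    have h5 : 2 * τ - τ = τ := by ring
    rw [h5] at h1
    linarith
  set B := b * τ ^ (-((m + 2) / 2 * n * (p - 1))) with hB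
  have hB0 : 0 < B := by positivity
  have hNy : ∀ r ∈ Icc (2 * τ) (3 * τ), B * |y r| ^ p ≤ N r := fun r hr => by
    have hr0 : 0 ≤ r := by linarith [hr.1]
    have h1 := hhol r ⟨hr0, hr.2⟩
    have h2 : 1 + (R + tricomiPhi m r) ≤ D * τ ^ ((m + 2) / 2) := by
      have h3 := (one_add_cone_bounds hm hR (by linarith : 1 ≤ 3 * τ)).2
      have h4 := tricomiPhi_mono hm hr0 hr.2
      rw [Real.mul_rpow (by norm_num) hτ.le] at h3
      rw [hD]
      linarith
    have h5 : ((1 + (R + tricomiPhi m r)) ^ n * V) ^ (p - 1)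
        ≤ ((D * τ ^ ((m + 2) / 2)) ^ n * V) ^ (p - 1) := by
      have := tricomiPhi_nonneg hm hr0
      gcongr
    have h6 : ((D * τ ^ ((m + 2) / 2)) ^ n * V) ^ (p - 1) = B⁻¹ := by
      rw [mul_pow, mul_right_comm, Real.mul_rpow (by positivity) (by positivity),
        ← Real.rpow_natCast (τ ^ ((m + 2) / 2)), ← Real.rpow_mul hτ.le, ← Real.rpow_mul hτ.le,
        hB, mul_inv, ← Real.rpow_neg hτ.le, neg_neg, hb, inv_inv]
    rw [h6] at h5
    have h7 : |y r| ^ p ≤ N r * B⁻¹ := h1.trans (mul_le_mul_of_nonneg_left h5 (hN0 r))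
    rwa [← div_eq_mul_inv, le_div_iff₀' hB0] at h7
  have hsub : Icc (2 * τ) (3 * τ) ⊆ Icc 0 (3 * τ) := Icc_subset_Icc_left (by linarith)
  have hlt := length_lt_of_superlinear (N := N) hp hB0 hY0 (by linarith : 2 * τ ≤ 3 * τ)
    (fun r hr => (hy r (hsub hr)).mono hsub)
    (fun s t c' hs hst ht => hinc s t c' (by linarith) hst ht) hNy hY2
    (hE _ ⟨by linarith, by linarith⟩)
  have h1 : 3 * τ - 2 * τ = τ := by ring
  rw [h1, lt_div_iff₀ hθ0] at hlt
  have h2 : (τ * θ) ^ 2 < 2 / (B * Y ^ (p - 1)) :=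
    (Real.lt_sqrt (by positivity)).1 hlt
  have hYp : Y ^ (p - 1) = (c * k / 2) ^ (p - 1) * ε ^ (p * (p - 1)) *
      τ ^ ((2 - α) * (p - 1)) := by
    rw [hY, Real.mul_rpow (by positivity) (by positivity),
      Real.mul_rpow (by positivity) (by positivity), ← Real.rpow_mul hε.le, ← Real.rpow_mul hτ.le]
  have hexp : τ ^ (tricomiGamma m n p / 2)
      = τ ^ 2 * τ ^ (-((m + 2) / 2 * n * (p - 1))) * τ ^ ((2 - α) * (p - 1)) := by
    rw [← Real.rpow_natCast τ 2, ← Real.rpow_add hτ, ← Real.rpow_add hτ]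
    congr 1
    rw [hα]
    simp only [tricomiGamma]
    push_cast
    ring
  rw [lt_div_iff₀ (by positivity), hYp, hB] at h2
  rw [lt_div_iff₀ (by positivity), hexp, lt_div_iff₀ (by positivity)]
  refine lt_of_le_of_lt (le_of_eq ?_) h2
  ring

/-- The lifespan bound follows from `exists_rpow_mul_rpow_lt` at the time `τ = C₀ ε ^ (-e)`, where the
power of `ε` cancels. -/
theorem theorem1p1 (n : ℕ) (hn : 1 ≤ n) (m p pc R : ℝ) (hm : 0 < m)
    (hpc_pos : 0 < pc) (hpc : tricomiGamma m n pc = 0) (hp : 1 < p) (hp_sub : p < pc)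
    (u₀ u₁ : EuclideanSpace ℝ (Fin n) → ℝ)
    (hu₀ : ContDiff ℝ ∞ u₀) (hu₁ : ContDiff ℝ ∞ u₁)
    (hu₀_nonneg : ∀ x, 0 ≤ u₀ x) (hu₁_nonneg : ∀ x, 0 ≤ u₁ x)
    (hu₀_supp : tsupport u₀ ⊆ Metric.closedBall 0 R)
    (hu₁_supp : tsupport u₁ ⊆ Metric.closedBall 0 R)
    (hne : u₀ ≠ 0 ∨ u₁ ≠ 0) (ε₀ : ℝ) (hε₀ : 0 < ε₀) :
    ∃ C : ℝ, 0 < C ∧ ∀ ε : ℝ, 0 < ε → ε ≤ ε₀ →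
      lifespan m p R u₀ u₁ ε < ⊤ ∧
      lifespan m p R u₀ u₁ ε
        ≤ ENNReal.ofReal (C * ε ^ (-(2 * p * (p - 1) / tricomiGamma m n p))) := by
  have hγ : 0 < tricomiGamma m n p := tricomiGamma_pos hn hm hpc (by linarith) hp_sub
  have hR : 0 ≤ R := by
    have hpt : ∀ {v : EuclideanSpace ℝ (Fin n) → ℝ}, tsupport v ⊆ Metric.closedBall 0 R →
        v ≠ 0 → 0 ≤ R := by
      intro v hv hv0
      obtain ⟨x, hx⟩ := Function.ne_iff.1 hv0
      exact (norm_nonneg x).trans (mem_closedBall_zero_iff.1 (hv (subset_tsupport v hx)))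
    exact hne.elim (hpt hu₀_supp) (hpt hu₁_supp)
  obtain ⟨t₁, K, ht₁, hK, hbound⟩ := exists_rpow_mul_rpow_lt hn hm hp hR hu₀.continuous
    hu₁.continuous hu₀_nonneg hu₁_nonneg hu₀_supp hu₁_supp hne
  set γ := tricomiGamma m n p with hγdef
  set e := 2 * p * (p - 1) / γ with he
  have hp1 : 0 < p - 1 := by linarith
  have he0 : 0 < e := by positivity
  set C₀ := max (K ^ (2 / γ)) (t₁ * ε₀ ^ e) with hC₀
  have hC₀0 : 0 < C₀ := lt_max_of_lt_left (by positivity)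
  refine ⟨3 * C₀, by positivity, fun ε hε hεε₀ => ?_⟩
  have hle : lifespan m p R u₀ u₁ ε ≤ ENNReal.ofReal (3 * C₀ * ε ^ (-e)) := by
    refine sSup_le ?_
    rintro T ⟨u, ⟨w, g, hsol⟩, hcone⟩
    by_contra! hlt
    set τ := C₀ * ε ^ (-e) with hτ
    have hτ0 : 0 < τ := by positivity
    have hτt : t₁ ≤ τ := by
      calc t₁ = t₁ * ε₀ ^ e * ε₀ ^ (-e) := by
            rw [mul_assoc, ← Real.rpow_add hε₀, add_neg_cancel, Real.rpow_zero, mul_one]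
        _ ≤ C₀ * ε ^ (-e) := by
            refine mul_le_mul (le_max_right _ _) ?_ (by positivity) hC₀0.le
            exact Real.rpow_le_rpow_of_nonpos hε hεε₀ (by linarith)
    have h1 := hbound ε T u w g hε hsol hcone τ hτt ⟨by positivity, by rwa [hτ, ← mul_assoc]⟩
    have h2 : τ ^ (γ / 2) = C₀ ^ (γ / 2) * ε ^ (-(p * (p - 1))) := by
      rw [hτ, Real.mul_rpow hC₀0.le (by positivity), ← Real.rpow_mul hε.le]
      congr 2
      rw [he]; field_simp
    have h3 : K ≤ C₀ ^ (γ / 2) := by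
      calc K = (K ^ (2 / γ)) ^ (γ / 2) := by
            rw [← Real.rpow_mul hK.le, show 2 / γ * (γ / 2) = 1 by field_simp, Real.rpow_one]
        _ ≤ C₀ ^ (γ / 2) := by gcongr; exact le_max_left _ _
    rw [h2, mul_left_comm, ← Real.rpow_add hε, add_neg_cancel, Real.rpow_zero, mul_one] at h1
    linarith
  exact ⟨hle.trans_lt ENNReal.ofReal_lt_top, hle⟩
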